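/- An instance of Max Domination on unit disk graphs (with weighted vertices and unit costs) consists of points $p_1,\dots,p_n\in\mathbb R^2$, a diameter $d>0$, weights $w_1,\dots,w_n\ge 0$ and a budget $L\in\mathbb N$. Its graph has vertex set $\{1,\dots,n\}$, and $i\ne j$ are adjacent if and only if $\|p_i-p_j\|_2\le d$. A selection $S\subseteq\{1,\dots,n\}$ is feasible if $|S|\le L$, and its payoff is $\sum_{v\in N[S]}w_v$, where $N[S]$ is the set of all vertices that belong to $S$ or are adjacent to a member of $S$. Let $\mathrm{OPT}$ be the maximal payoff of a feasible selection. For every real $\ell>1$ there is a deterministic $(1-2/\ell)$-approximation algorithm for this problem with running time $n^{O(\ell^2)}$. That is, there is an absolute constant $C$ such that for every real $\ell>1$ there is a real RAM program (unit cost per elementary operation; memory of natural numbers and of reals with computed addresses; addition, truncated subtraction and comparison of natural numbers; addition, subtraction, multiplication and exact comparison of reals; integer constants; no rounding) which, on every instance, halts after at most $\max(n,2)^{C\ell^2}$ steps and outputs a feasible selection whose payoff is at least $(1-2/\ell)\,\mathrm{OPT}$. -/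

import Mathlib

/-! ### Max domination on unit disk graphs -/

/-- The unit disk (intersection) graph of a finite family of points of the Euclidean plane:
two different indices are adjacent iff their points are at distance at most `d`. -/
def unitDiskGraph {n : ℕ} (p : Fin n → EuclideanSpace ℝ (Fin 2)) (d : ℝ) :
    SimpleGraph (Fin n) where
  Adj i j := i ≠ j ∧ dist (p i) (p j) ≤ d
  symm := ⟨fun _ _ h => ⟨h.1.symm, by rw [dist_comm]; exact h.2⟩⟩
  loopless := ⟨fun _ h => h.1 rfl⟩

open Classical in
/-- The vertices covered by `S`: the members of `S` and all their neighbors. -/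
noncomputable def SimpleGraph.dominatedBy {V : Type*} [Fintype V] (G : SimpleGraph V)
    (S : Finset V) : Finset V :=
  Finset.univ.filter fun v => ∃ u ∈ S, u = v ∨ G.Adj u v

/-- The total weight of the vertices covered by `S`. -/
noncomputable def SimpleGraph.coveredWeight {V : Type*} [Fintype V] (G : SimpleGraph V)
    (w : V → ℝ) (S : Finset V) : ℝ :=
  ∑ v ∈ G.dominatedBy S, w v

/-- An instance of max domination on unit disk graphs with weighted vertices and unit costs. -/
structure UnitDiskInstance where
  /-- number of points -/
  n : ℕ
  /-- the points -/
  point : Fin n → EuclideanSpace ℝ (Fin 2)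
  /-- the diameter of the disks -/
  diam : ℝ
  diam_pos : 0 < diam
  /-- the profit for covering a vertex -/
  weight : Fin n → ℝ
  weight_nonneg : ∀ i, 0 ≤ weight i
  /-- the budget: how many vertices may be selected -/
  budget : ℕ

namespace UnitDiskInstance

/-- The graph of the instance. -/
def graph (I : UnitDiskInstance) : SimpleGraph (Fin I.n) :=
  unitDiskGraph I.point I.diam

/-- Every vertex costs one, so `S` is feasible iff it has at most `budget` members. -/
def Feasible (I : UnitDiskInstance) (S : Finset (Fin I.n)) : Prop :=
  S.card ≤ I.budget

/-- The payoff of a selection of vertices. -/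
noncomputable def payoff (I : UnitDiskInstance) (S : Finset (Fin I.n)) : ℝ :=
  I.graph.coveredWeight I.weight S

/-- `S` is feasible and its payoff is at least `ρ` times the optimal payoff, i.e. at least
`ρ` times the payoff of every feasible selection. -/
def IsApproxSolution (I : UnitDiskInstance) (ρ : ℝ) (S : Finset (Fin I.n)) : Prop :=
  I.Feasible S ∧ ∀ T : Finset (Fin I.n), I.Feasible T → ρ * I.payoff T ≤ I.payoff S

end UnitDiskInstance

/-! ### Real RAM

A deterministic random access machine, programmed with structured control flow. It has natural
number registers and arrays (addition, truncated subtraction, comparison) and real registers and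
arrays (ring operations, exact comparison). Array entries are addressed indirectly, by computed
natural numbers. There is no rounding of reals, no conversion of a real into a natural number, no
multiplication of natural numbers, and the only real constants are integers. Every elementary
operation costs one unit. -/

namespace RealRAM

/-- The memory: registers and arrays are named by natural numbers. -/
structure Store where
  nreg : ℕ → ℕ
  narr : ℕ → ℕ → ℕ
  rreg : ℕ → ℝ
  rarr : ℕ → ℕ → ℝ

/-- Expressions with values in the natural numbers. -/
inductive NExpr where
  | const (c : ℕ)
  | reg (x : ℕ)
  | get (a : ℕ) (i : NExpr)
  | add (e f : NExpr)
  | sub (e f : NExpr)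

/-- Expressions with values in the reals. -/
inductive RExpr where
  | const (c : ℤ)
  | reg (x : ℕ)
  | get (a : ℕ) (i : NExpr)
  | add (e f : RExpr)
  | sub (e f : RExpr)
  | mul (e f : RExpr)

/-- Tests. -/
inductive BExpr where
  | nle (e f : NExpr)
  | rle (e f : RExpr)
  | not (b : BExpr)
  | and (b c : BExpr)

/-- Programs. -/
inductive Prog where
  | nop
  | nset (x : ℕ) (e : NExpr)
  | nput (a : ℕ) (i e : NExpr)
  | rset (x : ℕ) (e : RExpr)
  | rput (a : ℕ) (i : NExpr) (e : RExpr)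
  | seq (p q : Prog)
  | cond (b : BExpr) (p q : Prog)
  | loop (b : BExpr) (p : Prog)

/-- The value of an expression. -/
def NExpr.val (s : Store) : NExpr → ℕ
  | .const c => c
  | .reg x => s.nreg x
  | .get a i => s.narr a (i.val s)
  | .add e f => e.val s + f.val s
  | .sub e f => e.val s - f.val s

/-- The number of elementary operations needed to evaluate an expression. -/
def NExpr.cost : NExpr → ℕ
  | .const _ => 1
  | .reg _ => 1
  | .get _ i => i.cost + 1
  | .add e f => e.cost + f.cost + 1
  | .sub e f => e.cost + f.cost + 1

/-- The value of an expression. -/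
noncomputable def RExpr.val (s : Store) : RExpr → ℝ
  | .const c => (c : ℝ)
  | .reg x => s.rreg x
  | .get a i => s.rarr a (i.val s)
  | .add e f => e.val s + f.val s
  | .sub e f => e.val s - f.val s
  | .mul e f => e.val s * f.val s

/-- The number of elementary operations needed to evaluate an expression. -/
def RExpr.cost : RExpr → ℕ
  | .const _ => 1
  | .reg _ => 1
  | .get _ i => i.cost + 1
  | .add e f => e.cost + f.cost + 1
  | .sub e f => e.cost + f.cost + 1
  | .mul e f => e.cost + f.cost + 1

/-- The outcome of a test. -/
def BExpr.holds (s : Store) : BExpr → Prop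
  | .nle e f => e.val s ≤ f.val s
  | .rle e f => e.val s ≤ f.val s
  | .not b => ¬ b.holds s
  | .and b c => b.holds s ∧ c.holds s

/-- The number of elementary operations needed to perform a test. -/
def BExpr.cost : BExpr → ℕ
  | .nle e f => e.cost + f.cost + 1
  | .rle e f => e.cost + f.cost + 1
  | .not b => b.cost + 1
  | .and b c => b.cost + c.cost + 1

/-- Write `v` into the natural number register `x`. -/
def Store.setNReg (s : Store) (x v : ℕ) : Store :=
  { s with nreg := Function.update s.nreg x v }

/-- Write `v` into entry `i` of the natural number array `a`. -/
def Store.setNArr (s : Store) (a i v : ℕ) : Store :=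
  { s with narr := Function.update s.narr a (Function.update (s.narr a) i v) }

/-- Write `v` into the real register `x`. -/
noncomputable def Store.setRReg (s : Store) (x : ℕ) (v : ℝ) : Store :=
  { s with rreg := Function.update s.rreg x v }

/-- Write `v` into entry `i` of the real array `a`. -/
noncomputable def Store.setRArr (s : Store) (a i : ℕ) (v : ℝ) : Store :=
  { s with rarr := Function.update s.rarr a (Function.update (s.rarr a) i v) }

/-- `Run p s t s'`: the program `p`, started in the store `s`, halts after exactly `t` elementary
operations in the store `s'`. -/
inductive Run : Prog → Store → ℕ → Store → Prop
  | nop (s : Store) : Run .nop s 1 s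
  | nset (s : Store) (x : ℕ) (e : NExpr) :
      Run (.nset x e) s (e.cost + 1) (s.setNReg x (e.val s))
  | nput (s : Store) (a : ℕ) (i e : NExpr) :
      Run (.nput a i e) s (i.cost + e.cost + 1) (s.setNArr a (i.val s) (e.val s))
  | rset (s : Store) (x : ℕ) (e : RExpr) :
      Run (.rset x e) s (e.cost + 1) (s.setRReg x (e.val s))
  | rput (s : Store) (a : ℕ) (i : NExpr) (e : RExpr) :
      Run (.rput a i e) s (i.cost + e.cost + 1) (s.setRArr a (i.val s) (e.val s))
  | seq {p q : Prog} {s s' s'' : Store} {t u : ℕ} :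
      Run p s t s' → Run q s' u s'' → Run (.seq p q) s (t + u) s''
  | cond_true {b : BExpr} {p q : Prog} {s s' : Store} {t : ℕ} :
      b.holds s → Run p s t s' → Run (.cond b p q) s (b.cost + 1 + t) s'
  | cond_false {b : BExpr} {p q : Prog} {s s' : Store} {t : ℕ} :
      ¬ b.holds s → Run q s t s' → Run (.cond b p q) s (b.cost + 1 + t) s'
  | loop_true {b : BExpr} {p : Prog} {s s' s'' : Store} {t u : ℕ} :
      b.holds s → Run p s t s' → Run (.loop b p) s' u s'' →
        Run (.loop b p) s (b.cost + 1 + t + u) s''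
  | loop_false {b : BExpr} {p : Prog} {s : Store} :
      ¬ b.holds s → Run (.loop b p) s (b.cost + 1) s

end RealRAM

namespace UnitDiskInstance

/-- The first `n` entries of an array hold `f`, the others are zero. -/
noncomputable def toArray {n : ℕ} (f : Fin n → ℝ) (i : ℕ) : ℝ :=
  if h : i < n then f ⟨i, h⟩ else 0

/-- The initial memory of a machine that is given the instance: natural number registers 0 and 1
hold the number of points and the budget, real register 0 holds the diameter, real arrays 0, 1
and 2 hold the two coordinates of the points and the weights; everything else is zero. -/
noncomputable def input (I : UnitDiskInstance) : RealRAM.Store where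
  nreg x := if x = 0 then I.n else if x = 1 then I.budget else 0
  narr _ _ := 0
  rreg x := if x = 0 then I.diam else 0
  rarr a :=
    if a = 0 then toArray fun i => I.point i 0
    else if a = 1 then toArray fun i => I.point i 1
    else if a = 2 then toArray I.weight
    else fun _ => 0

/-- The selection that a machine outputs: the indices at which the natural number array 0 is
nonzero. -/
def output (I : UnitDiskInstance) (s : RealRAM.Store) : Finset (Fin I.n) :=
  Finset.univ.filter fun i => s.narr 0 i ≠ 0

end UnitDiskInstance

/-! The algorithm is a shifted grid combined with a dynamic program over the budget. The machine
cannot round reals, so grid cells are defined combinatorially. The `level` of a coordinate is the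
length of the longest chain of coordinates ending in it whose consecutive steps exceed `d / 2`.
Coordinates of equal level differ by at most `d / 2` (`sub_le_of_level_eq`), so two points that
agree in both levels are adjacent or equal (`near_of_level_eq`). Coordinates that differ by at most
`d` have levels that differ by at most 2 (`level_le_add_two`).

Fix `K` and group the cells into `K × K` blocks, shifted diagonally by `a < K`. Count a vertex as
covered only if a selected vertex of its own block covers it. Adjacent vertices are separated by at
most 2 shifts per axis, hence by at most 4 in all. Averaging over the `K` shifts gives one that
keeps a fraction `1 - 4 / K` of the payoff of any given selection (`exists_shift_coverage`).

For a fixed shift the blocks do not interact (`coverage_union`). One representative of each occupied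
cell covers a whole block, so no block needs more than `K * K` selected vertices
(`smallDominators_blockOf`). An optimal selection for each budget up to `n` is therefore found by
adding the blocks one at a time and trying all tuples of `K * K` vertices
(`SmallDominators.exists_extension`, `reach_nest_tryCand`). The best result over all shifts is
output; its true payoff is at least its coverage within blocks.

With `K = ⌈2ℓ⌉` the loss `4 / K` is at most `2 / ℓ`. The enumeration dominates the running time,
which is bounded by a power of `n + 2` with exponent quadratic in `K`. All time bounds are kept in
this form: a sequence adds one to the larger exponent, and nested loops add their exponents up to
constants. -/

/-! ### Reasoning about programs -/

namespace RealRAM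

/-- The program contains an assignment to the natural number register `x`. -/
def Prog.WritesNReg (x : ℕ) : Prog → Prop
  | .nset y _ => x = y
  | .seq p q => p.WritesNReg x ∨ q.WritesNReg x
  | .cond _ p q => p.WritesNReg x ∨ q.WritesNReg x
  | .loop _ p => p.WritesNReg x
  | _ => False

/-- The program contains an assignment to the natural number array `a`. -/
def Prog.WritesNArr (a : ℕ) : Prog → Prop
  | .nput b _ _ => a = b
  | .seq p q => p.WritesNArr a ∨ q.WritesNArr a
  | .cond _ p q => p.WritesNArr a ∨ q.WritesNArr a
  | .loop _ p => p.WritesNArr a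
  | _ => False

/-- The program contains an assignment to the real register `x`. -/
def Prog.WritesRReg (x : ℕ) : Prog → Prop
  | .rset y _ => x = y
  | .seq p q => p.WritesRReg x ∨ q.WritesRReg x
  | .cond _ p q => p.WritesRReg x ∨ q.WritesRReg x
  | .loop _ p => p.WritesRReg x
  | _ => False

/-- The program contains an assignment to the real array `a`. -/
def Prog.WritesRArr (a : ℕ) : Prog → Prop
  | .rput b _ _ => a = b
  | .seq p q => p.WritesRArr a ∨ q.WritesRArr a
  | .cond _ p q => p.WritesRArr a ∨ q.WritesRArr a
  | .loop _ p => p.WritesRArr a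
  | _ => False

/-- The two stores agree on everything the program does not write to. -/
structure Frame (p : Prog) (s s' : Store) : Prop where
  nreg : ∀ x, ¬ p.WritesNReg x → s'.nreg x = s.nreg x
  narr : ∀ a, ¬ p.WritesNArr a → s'.narr a = s.narr a
  rreg : ∀ x, ¬ p.WritesRReg x → s'.rreg x = s.rreg x
  rarr : ∀ a, ¬ p.WritesRArr a → s'.rarr a = s.rarr a

theorem Frame.refl (p : Prog) (s : Store) : Frame p s s :=
  ⟨fun _ _ => rfl, fun _ _ => rfl, fun _ _ => rfl, fun _ _ => rfl⟩

theorem Frame.trans {p : Prog} {s s' s'' : Store} (h : Frame p s s') (h' : Frame p s' s'') :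
    Frame p s s'' :=
  ⟨fun x hx => (h'.nreg x hx).trans (h.nreg x hx), fun x hx => (h'.narr x hx).trans (h.narr x hx),
    fun x hx => (h'.rreg x hx).trans (h.rreg x hx), fun x hx => (h'.rarr x hx).trans (h.rarr x hx)⟩

theorem Frame.mono {p q : Prog} {s s' : Store} (h : Frame p s s')
    (h₁ : ∀ x, p.WritesNReg x → q.WritesNReg x) (h₂ : ∀ x, p.WritesNArr x → q.WritesNArr x)
    (h₃ : ∀ x, p.WritesRReg x → q.WritesRReg x) (h₄ : ∀ x, p.WritesRArr x → q.WritesRArr x) :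
    Frame q s s' :=
  ⟨fun x hx => h.nreg x fun h' => hx (h₁ x h'), fun x hx => h.narr x fun h' => hx (h₂ x h'),
    fun x hx => h.rreg x fun h' => hx (h₃ x h'), fun x hx => h.rarr x fun h' => hx (h₄ x h')⟩

/-- This turns a syntactic check of the assignments in a program into an invariant. Later proofs
settle the persistence of registers and arrays by `simp` on the write sets. -/
theorem Run.frame {p : Prog} {s s' : Store} {t : ℕ} (h : Run p s t s') : Frame p s s' := by
  induction h with
  | nop s => exact Frame.refl _ _
  | nset s x e =>
    refine ⟨fun y hy => ?_, fun _ _ => rfl, fun _ _ => rfl, fun _ _ => rfl⟩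
    exact Function.update_of_ne hy _ _
  | nput s a i e =>
    refine ⟨fun _ _ => rfl, fun y hy => ?_, fun _ _ => rfl, fun _ _ => rfl⟩
    exact Function.update_of_ne hy _ _
  | rset s x e =>
    refine ⟨fun _ _ => rfl, fun _ _ => rfl, fun y hy => ?_, fun _ _ => rfl⟩
    exact Function.update_of_ne hy _ _
  | rput s a i e =>
    refine ⟨fun _ _ => rfl, fun _ _ => rfl, fun _ _ => rfl, fun y hy => ?_⟩
    exact Function.update_of_ne hy _ _
  | seq _ _ ih₁ ih₂ =>
    exact (ih₁.mono (fun _ => Or.inl) (fun _ => Or.inl) (fun _ => Or.inl) (fun _ => Or.inl)).trans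
      (ih₂.mono (fun _ => Or.inr) (fun _ => Or.inr) (fun _ => Or.inr) (fun _ => Or.inr))
  | cond_true _ _ ih =>
    exact ih.mono (fun _ => Or.inl) (fun _ => Or.inl) (fun _ => Or.inl) (fun _ => Or.inl)
  | cond_false _ _ ih =>
    exact ih.mono (fun _ => Or.inr) (fun _ => Or.inr) (fun _ => Or.inr) (fun _ => Or.inr)
  | loop_true _ _ _ ih₁ ih₂ =>
    exact Frame.trans (Frame.mono ih₁ (fun _ => id) (fun _ => id) (fun _ => id) (fun _ => id)) ih₂
  | loop_false _ => exact Frame.refl _ _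

/-- Started in `s`, the program halts after at most `(n + 2) ^ k` steps in a store with
property `Q`. -/
def Reach (n : ℕ) (p : Prog) (s : Store) (k : ℕ) (Q : Store → Prop) : Prop :=
  ∃ t s', Run p s t s' ∧ t ≤ (n + 2) ^ k ∧ Q s'

theorem two_pow_le (n k : ℕ) : 2 ^ k ≤ (n + 2) ^ k := Nat.pow_le_pow_left (by omega) k

/-- The base is at least 2, so doubling a power is paid for by one more factor. Hence composing two
programs raises the exponent by only one. -/
theorem add_le_base_pow {n a b i j k : ℕ} (ha : a ≤ (n + 2) ^ i) (hb : b ≤ (n + 2) ^ j)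
    (hi : i < k) (hj : j < k) : a + b ≤ (n + 2) ^ k := by
  obtain ⟨k, rfl⟩ : ∃ m, k = m + 1 := ⟨k - 1, by omega⟩
  have h₁ : (n + 2) ^ i ≤ (n + 2) ^ k := Nat.pow_le_pow_right (by omega) (by omega)
  have h₂ : (n + 2) ^ j ≤ (n + 2) ^ k := Nat.pow_le_pow_right (by omega) (by omega)
  rw [pow_succ]
  nlinarith [Nat.zero_le ((n + 2) ^ k * n)]

namespace Reach

variable {n k i j : ℕ} {p q : Prog} {s : Store} {Q R : Store → Prop}

theorem imp (h : Reach n p s i Q) (hi : i ≤ k) (hQ : ∀ s', Frame p s s' → Q s' → R s') :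
    Reach n p s k R := by
  obtain ⟨t, s', h₁, h₂, h₃⟩ := h
  exact ⟨t, s', h₁, h₂.trans (Nat.pow_le_pow_right (by omega) hi), hQ s' h₁.frame h₃⟩

theorem nop (h : Q s) : Reach n .nop s k Q :=
  ⟨1, s, .nop s, Nat.one_le_pow _ _ (by omega), h⟩

theorem nset {x : ℕ} {e : NExpr} (hc : e.cost + 1 ≤ 2 ^ k) (h : Q (s.setNReg x (e.val s))) :
    Reach n (.nset x e) s k Q :=
  ⟨_, _, .nset s x e, hc.trans (two_pow_le n k), h⟩

theorem nput {a : ℕ} {d e : NExpr} (hc : d.cost + e.cost + 1 ≤ 2 ^ k)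
    (h : Q (s.setNArr a (d.val s) (e.val s))) : Reach n (.nput a d e) s k Q :=
  ⟨_, _, .nput s a d e, hc.trans (two_pow_le n k), h⟩

theorem rset {x : ℕ} {e : RExpr} (hc : e.cost + 1 ≤ 2 ^ k) (h : Q (s.setRReg x (e.val s))) :
    Reach n (.rset x e) s k Q :=
  ⟨_, _, .rset s x e, hc.trans (two_pow_le n k), h⟩

theorem rput {a : ℕ} {d : NExpr} {e : RExpr} (hc : d.cost + e.cost + 1 ≤ 2 ^ k)
    (h : Q (s.setRArr a (d.val s) (e.val s))) : Reach n (.rput a d e) s k Q :=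
  ⟨_, _, .rput s a d e, hc.trans (two_pow_le n k), h⟩

theorem seq (h₁ : Reach n p s i R)
    (h₂ : ∀ s', Frame p s s' → R s' → Reach n q s' j Q) (hi : i < k) (hj : j < k) :
    Reach n (.seq p q) s k Q := by
  obtain ⟨t, s', h, ht, hs'⟩ := h₁
  obtain ⟨t', s'', h', ht', hs''⟩ := h₂ s' h.frame hs'
  exact ⟨_, _, .seq h h', add_le_base_pow ht ht' hi hj, hs''⟩

theorem cond {b : BExpr} (hc : b.cost + 1 ≤ 2 ^ i) (h₁ : b.holds s → Reach n p s j Q)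
    (h₂ : ¬ b.holds s → Reach n q s j Q) (hi : i < k) (hj : j < k) :
    Reach n (.cond b p q) s k Q := by
  by_cases hb : b.holds s
  · obtain ⟨t, s', h, ht, hs'⟩ := h₁ hb
    exact ⟨_, _, .cond_true hb h, add_le_base_pow (hc.trans (two_pow_le n i)) ht hi hj, hs'⟩
  · obtain ⟨t, s', h, ht, hs'⟩ := h₂ hb
    exact ⟨_, _, .cond_false hb h, add_le_base_pow (hc.trans (two_pow_le n i)) ht hi hj, hs'⟩

end Reach

/-- Run `p` for the values `0, …, e - 1` of the register `x`. -/
def forN (x : ℕ) (e : NExpr) (p : Prog) : Prog :=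
  .seq (.nset x (.const 0))
    (.loop (.not (.nle e (.reg x))) (.seq p (.nset x (.add (.reg x) (.const 1)))))

section forN

variable {x y : ℕ} {e : NExpr} {p : Prog}

@[simp] theorem writesNReg_forN : (forN x e p).WritesNReg y ↔ y = x ∨ p.WritesNReg y := by
  simp only [forN, Prog.WritesNReg]; tauto

@[simp] theorem writesNArr_forN : (forN x e p).WritesNArr y ↔ p.WritesNArr y := by
  simp [forN, Prog.WritesNArr]

@[simp] theorem writesRReg_forN : (forN x e p).WritesRReg y ↔ p.WritesRReg y := by
  simp [forN, Prog.WritesRReg]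

@[simp] theorem writesRArr_forN : (forN x e p).WritesRArr y ↔ p.WritesRArr y := by
  simp [forN, Prog.WritesRArr]

theorem frame_setNReg_forN (s : Store) (v : ℕ) : Frame (forN x e p) s (s.setNReg x v) := by
  refine ⟨fun y hy => ?_, fun _ _ => rfl, fun _ _ => rfl, fun _ _ => rfl⟩
  rw [writesNReg_forN] at hy
  exact Function.update_of_ne (fun h => hy (Or.inl h)) _ _

theorem Frame.forN {s s' : Store} (h : Frame p s s') : Frame (forN x e p) s s' :=
  h.mono (by simp +contextual) (by simp) (by simp) (by simp)

/-- The rule for bounded loops. -/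
theorem Reach.forN {n j k k' : ℕ} {s : Store} (N : ℕ) (Inv : ℕ → Store → Prop)
    (hN : N ≤ (n + 2) ^ j) (hc : e.cost ≤ 8) (hk : j + k + 6 ≤ k')
    (he : ∀ s', Frame (RealRAM.forN x e p) s s' → e.val s' = N)
    (hx : ∀ i s' v, Inv i s' → Inv i (s'.setNReg x v)) (hp : ¬ p.WritesNReg x) (h0 : Inv 0 s)
    (hstep : ∀ i < N, ∀ s', Frame (RealRAM.forN x e p) s s' → s'.nreg x = i → Inv i s' →
      Reach n p s' k (Inv (i + 1))) :
    Reach n (RealRAM.forN x e p) s k' (Inv N) := by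
  obtain ⟨B, hB⟩ : ∃ B, B = n + 2 := ⟨_, rfl⟩
  rw [← hB] at hN
  -- Induction on the number `m` of remaining iterations. Since `e.cost ≤ 8`, test and increment
  -- cost at most 12 + 4 = 16 per iteration, and the final failing test costs at most 12.
  have main : ∀ m i s', i + m = N → Frame (RealRAM.forN x e p) s s' → s'.nreg x = i → Inv i s' →
      ∃ t s'', Run (.loop (.not (.nle e (.reg x)))
        (.seq p (.nset x (.add (.reg x) (.const 1))))) s' t s'' ∧
        t ≤ m * (16 + B ^ k) + 12 ∧ Inv N s'' := by
    intro m
    induction m with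
    | zero =>
      intro i s' him hf hi hs
      have := he s' hf
      refine ⟨_, s', .loop_false ?_, ?_, by rwa [← him]⟩
      · simp only [BExpr.holds, NExpr.val, not_not]; omega
      · simp only [BExpr.cost, NExpr.cost]; omega
    | succ m ih =>
      intro i s' him hf hi hs
      have hv := he s' hf
      obtain ⟨t, s₁, hr, ht, hs₁⟩ := hstep i (by omega) s' hf hi hs
      have hfr := hr.frame
      rw [← hB] at ht
      have hx₁ : s₁.nreg x = i := (hfr.nreg x hp).trans hi
      obtain ⟨t', s₂, hr', ht', hs₂⟩ := ih (i + 1) (s₁.setNReg x (i + 1)) (by omega)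
        ((hf.trans hfr.forN).trans (frame_setNReg_forN _ _))
        (by simp [Store.setNReg]) (hx _ _ _ hs₁)
      have hval : (NExpr.add (.reg x) (.const 1)).val s₁ = i + 1 := by simp [NExpr.val, hx₁]
      refine ⟨_, s₂, .loop_true ?_ (.seq hr (.nset _ _ _)) (hval ▸ hr'), ?_, hs₂⟩
      · simp only [BExpr.holds, NExpr.val]; omega
      · simp only [BExpr.cost, NExpr.cost]; rw [add_mul]; omega
  obtain ⟨t, s', hr, ht, hs'⟩ := main N 0 (s.setNReg x 0) (by omega) (frame_setNReg_forN _ _)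
    (by simp [Store.setNReg]) (hx _ _ _ h0)
  refine ⟨_, s', .seq (.nset _ _ _) hr, ?_, hs'⟩
  simp only [NExpr.cost, ← hB]
  have h1 : 1 ≤ B ^ k := Nat.one_le_pow _ _ (by omega)
  have h2 : 1 ≤ B ^ j := Nat.one_le_pow _ _ (by omega)
  have h3 : N * (16 + B ^ k) ≤ B ^ j * (16 + B ^ k) := Nat.mul_le_mul_right _ hN
  -- The whole overhead fits into a factor 64, which is at most `B ^ 6`; this is the 6 in the
  -- hypothesis on `k'`.
  have h4 : B ^ j * B ^ k * 64 ≤ B ^ j * B ^ k * B ^ 6 :=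
    Nat.mul_le_mul_left _ (hB ▸ two_pow_le n 6)
  have h5 : B ^ j * B ^ k * B ^ 6 ≤ B ^ k' := by
    rw [← pow_add, ← pow_add]; exact Nat.pow_le_pow_right (by omega) hk
  have h6 : B ^ j ≤ B ^ j * B ^ k := Nat.le_mul_of_pos_right _ h1
  nlinarith

end forN

/-- Run `p` for all values in `{0, …, nreg 0}` of the `m` registers from `100` on. -/
def nest (p : Prog) : ℕ → Prog
  | 0 => p
  | m + 1 => forN (100 + m) (.add (.reg 0) (.const 1)) (nest p m)

/-! ### Enumeration of all tuples by nested loops -/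

section nest

variable {p : Prog} {m y : ℕ}

theorem writesNReg_nest :
    (nest p m).WritesNReg y ↔ p.WritesNReg y ∨ (100 ≤ y ∧ y < 100 + m) := by
  induction m with
  | zero => simp [nest]
  | succ m ih =>
    simp only [nest, writesNReg_forN, ih]
    by_cases h : p.WritesNReg y
    · simp [h]
    · simp only [h, false_or]; omega

@[simp] theorem writesNArr_nest : (nest p m).WritesNArr y ↔ p.WritesNArr y := by
  induction m <;> simp_all [nest]

@[simp] theorem writesRReg_nest : (nest p m).WritesRReg y ↔ p.WritesRReg y := by
  induction m <;> simp_all [nest]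

@[simp] theorem writesRArr_nest : (nest p m).WritesRArr y ↔ p.WritesRArr y := by
  induction m <;> simp_all [nest]

/-- If every run of `p` preserves `Inv` and all `Good σ`, and establishes `Good σ` for the current
tuple `σ` of loop variables, then the nested loop establishes `Good σ` for all tuples. -/
theorem Reach.nest {n k k' : ℕ} (Inv : Store → Prop) (Good : (ℕ → ℕ) → Store → Prop)
    (hp : ∀ x, p.WritesNReg x → x ≠ 0 ∧ x < 100)
    (hn : ∀ s, Inv s → s.nreg 0 = n)
    (hInv : ∀ s x v, 100 ≤ x → Inv s → Inv (s.setNReg x v))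
    (hGood : ∀ σ s x v, 100 ≤ x → Good σ s → Good σ (s.setNReg x v))
    (hstep : ∀ s, Inv s → (∀ j < m, s.nreg (100 + j) ≤ n) → Reach n p s k fun s' => Inv s' ∧
      (∀ σ, Good σ s → Good σ s') ∧ ∀ σ, (∀ j < m, σ j = s.nreg (100 + j)) → Good σ s')
    (hk : k + 7 * m ≤ k') {s : Store} (hs : Inv s) :
    Reach n (RealRAM.nest p m) s k' fun s' => Inv s' ∧
      (∀ σ, Good σ s → Good σ s') ∧ ∀ σ, (∀ j < m, σ j ≤ n) → Good σ s' := by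
  -- Induction on the number `l` of inner loops: the registers from `100 + l` on are fixed, and
  -- `Good` is obtained for all tuples that agree with them. Each loop has `n + 1 ≤ (n + 2) ^ 1`
  -- iterations and so adds 1 + 6 = 7 to the exponent.
  have main : ∀ l ≤ m, ∀ s, Inv s → (∀ j < m, l ≤ j → s.nreg (100 + j) ≤ n) →
      Reach n (RealRAM.nest p l) s (k + 7 * l) fun s' => Inv s' ∧ (∀ σ, Good σ s → Good σ s') ∧
        ∀ σ, (∀ j < m, l ≤ j → σ j = s.nreg (100 + j)) → (∀ j < l, σ j ≤ n) → Good σ s' := by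
    intro l
    induction l with
    | zero =>
      intro _ s hs hb
      refine (hstep s hs fun j hj => hb j hj (Nat.zero_le _)).imp le_rfl ?_
      exact fun s' _ h => ⟨h.1, h.2.1, fun σ h' _ => h.2.2 σ fun j hj => h' j hj (Nat.zero_le _)⟩
    | succ l ih =>
      intro hl s hs hb
      have hfr : ∀ {s'}, Frame (RealRAM.nest p (l + 1)) s s' → ∀ j, l + 1 ≤ j →
          s'.nreg (100 + j) = s.nreg (100 + j) := by
        intro s' hf j hj
        refine hf.nreg _ fun h => ?_
        rw [writesNReg_nest] at h
        rcases h with h | h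
        · have := hp _ h; omega
        · omega
      refine (Reach.forN (j := 1) (k := k + 7 * l) (n + 1) (fun i s' => Inv s' ∧
        (∀ σ, Good σ s → Good σ s') ∧ ∀ σ, (∀ j < m, l + 1 ≤ j → σ j = s.nreg (100 + j)) →
          (∀ j < l, σ j ≤ n) → σ l < i → Good σ s') ?_ ?_ ?_ ?_ ?_ ?_ ?_ ?_).imp le_rfl ?_
      · simp
      · simp [NExpr.cost]
      · omega
      · intro s' hf
        have h0 : s'.nreg 0 = s.nreg 0 := hf.nreg 0 fun h => by
          have h := (writesNReg_nest (p := p) (m := l + 1)).1 h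
          rcases h with h | h
          · exact (hp _ h).1 rfl
          · omega
        simp [NExpr.val, h0, hn s hs]
      · rintro i s' v ⟨h₁, h₂, h₃⟩
        exact ⟨hInv _ _ _ (by omega) h₁, fun σ h => hGood _ _ _ _ (by omega) (h₂ σ h),
          fun σ h h' h'' => hGood _ _ _ _ (by omega) (h₃ σ h h' h'')⟩
      · rw [writesNReg_nest]
        rintro (h | h)
        · have := hp _ h; omega
        · omega
      · exact ⟨hs, fun σ h => h, fun σ _ _ h => absurd h (Nat.not_lt_zero _)⟩
      · rintro i hi s' hf hx ⟨h₁, h₂, h₃⟩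
        refine (ih (by omega) s' h₁ ?_).imp le_rfl ?_
        · intro j hj hlj
          rcases Nat.eq_or_lt_of_le hlj with rfl | hlt
          · omega
          · rw [hfr hf j hlt]; exact hb j hj hlt
        · rintro s'' - ⟨g₁, g₂, g₃⟩
          refine ⟨g₁, fun σ h => g₂ σ (h₂ σ h), fun σ h h' h'' => ?_⟩
          -- Tuples whose entry `l` is the current value are handled by this iteration; those with a
          -- smaller entry were handled before, and `Good` persists.
          rcases Nat.eq_or_lt_of_le (Nat.lt_succ_iff.1 h'') with heq | hlt
          · refine g₃ σ (fun j hj hlj => ?_) h'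
            rcases Nat.eq_or_lt_of_le hlj with rfl | hlt
            · rw [heq, hx]
            · rw [hfr hf j hlt]; exact h j hj hlt
          · exact g₂ σ (h₃ σ h h' hlt)
      · rintro s' - ⟨h₁, h₂, h₃⟩
        exact ⟨h₁, h₂, fun σ h h' => h₃ σ h (fun j hj => h' j (by omega))
          (Nat.lt_succ_of_le (h' l (by omega)))⟩
  refine (main m le_rfl s hs fun j hj hj' => absurd hj (by omega)).imp hk ?_
  exact fun s' _ h => ⟨h.1, h.2.1, fun σ h' => h.2.2 σ (fun j hj hj' => absurd hj (by omega)) h'⟩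

end nest

end RealRAM

/-! ### Levels, cells and classes of points -/

section Levels

/-- Coordinate `j` lies below coordinate `i` by more than half of `d`. -/
def Gap (x : ℕ → ℝ) (d : ℝ) (j i : ℕ) : Prop := d < (x i - x j) + (x i - x j)

open Classical in
-- The number of smaller coordinates is the measure for which the recursion of `level` terminates.
-- It also bounds the level.
theorem Gap.card_lt {x : ℕ → ℝ} {d : ℝ} (hd : 0 < d) {n i j : ℕ} (hj : j < n) (h : Gap x d j i) :
    ((Finset.range n).filter fun m => x m < x j).card <
      ((Finset.range n).filter fun m => x m < x i).card := by
  have hji : x j < x i := by unfold Gap at h; linarith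
  refine Finset.card_lt_card ⟨fun m hm => ?_, fun hsub => ?_⟩
  · simp only [Finset.mem_filter] at hm ⊢
    exact ⟨hm.1, hm.2.trans hji⟩
  · have := hsub (Finset.mem_filter.2 ⟨Finset.mem_range.2 hj, hji⟩)
    simp at this

open Classical in
/-- The length of the longest chain of gaps among the first `n` coordinates that ends in `i`. -/
noncomputable def level (x : ℕ → ℝ) (d : ℝ) (n : ℕ) (i : ℕ) : ℕ :=
  -- The conjunct `0 < d` is there for termination: for negative `d` every index would have a gap to
  -- itself.
  ((Finset.range n).filter fun j => 0 < d ∧ Gap x d j i).attach.sup fun j =>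
    level x d n j.1 + 1
termination_by ((Finset.range n).filter fun m => x m < x i).card
decreasing_by
  have hj := Finset.mem_filter.1 j.2
  exact Gap.card_lt hj.2.1 (Finset.mem_range.1 hj.1) hj.2.2

variable {x : ℕ → ℝ} {d : ℝ} {n : ℕ}

theorem level_lt_of_gap (hd : 0 < d) {i j : ℕ} (hj : j < n) (h : Gap x d j i) :
    level x d n j < level x d n i := by
  classical
  rw [level.eq_1 x d n i]
  exact Finset.le_sup (f := fun j : {j // j ∈ (Finset.range n).filter
    fun j => 0 < d ∧ Gap x d j i} => level x d n j.1 + 1)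
    (Finset.mem_attach _ ⟨j, Finset.mem_filter.2 ⟨Finset.mem_range.2 hj, hd, h⟩⟩)

theorem exists_gap_of_level_pos {i : ℕ} (h : 0 < level x d n i) :
    ∃ j < n, Gap x d j i ∧ level x d n i = level x d n j + 1 := by
  classical
  rw [level.eq_1] at h
  have hne : ((Finset.range n).filter fun j => 0 < d ∧ Gap x d j i).attach.Nonempty := by
    by_contra hne
    rw [Finset.not_nonempty_iff_eq_empty] at hne
    simp [hne] at h
  obtain ⟨j, -, hj⟩ := Finset.exists_mem_eq_sup _ hne fun j => level x d n j.1 + 1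
  have hm := Finset.mem_filter.1 j.2
  exact ⟨j.1, Finset.mem_range.1 hm.1, hm.2.2, by rw [level.eq_1]; exact hj⟩

/-- Coordinates strictly increase along a chain of gaps, so the level is at most the number of
smaller coordinates. The bound limits both the rounds of the level computation and the size of the
table of quotients. -/
theorem level_lt (hd : 0 < d) {i : ℕ} (hi : i < n) : level x d n i < n := by
  classical
  have key : ∀ m i, level x d n i = m → m ≤ ((Finset.range n).filter fun m => x m < x i).card := by
    intro m
    induction m with
    | zero => intro _ _; exact Nat.zero_le _
    | succ m ih =>
      intro i him
      obtain ⟨j, hj, hg, he⟩ := exists_gap_of_level_pos (x := x) (d := d) (n := n) (i := i) (by omega)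
      have h₁ := ih j (by omega)
      have h₂ := hg.card_lt hd hj
      omega
  refine (key _ i rfl).trans_lt ?_
  have : ((Finset.range n).filter fun m => x m < x i).card < (Finset.range n).card := by
    refine Finset.card_lt_card ⟨Finset.filter_subset _ _, fun h => ?_⟩
    have := Finset.mem_filter.1 (h (Finset.mem_range.2 hi))
    exact lt_irrefl _ this.2
  simpa using this

/-- Otherwise three gaps lead down from `v` to some `c`, a descent of more than `3d / 2`. Since `u`
is at most `d` below `v`, there is still a gap from `c` to `u`, so `c` has a level below that of
`u`; but its level is that of `v` minus 3. -/
theorem level_le_add_two (hd : 0 < d) {u v : ℕ} (h : x v - x u ≤ d) :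
    level x d n v ≤ level x d n u + 2 := by
  by_contra! hlt
  obtain ⟨a, ha, ga, ea⟩ := exists_gap_of_level_pos (x := x) (d := d) (n := n) (i := v) (by omega)
  obtain ⟨b, hb, gb, eb⟩ := exists_gap_of_level_pos (x := x) (d := d) (n := n) (i := a) (by omega)
  obtain ⟨c, hc, gc, ec⟩ := exists_gap_of_level_pos (x := x) (d := d) (n := n) (i := b) (by omega)
  have : Gap x d c u := by unfold Gap at *; linarith
  have := level_lt_of_gap hd hc this
  omega

theorem sub_le_of_level_eq (hd : 0 < d) {u v : ℕ} (hu : u < n)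
    (h : level x d n u = level x d n v) : 2 * (x v - x u) ≤ d := by
  by_contra! hlt
  have := level_lt_of_gap (n := n) hd hu (show Gap x d u v by unfold Gap; linarith)
  omega

end Levels

/-- The squared distance of `u` and `v` is at most `d * d`. -/
def Near (x y : ℕ → ℝ) (d : ℝ) (u v : ℕ) : Prop :=
  (x u - x v) * (x u - x v) + (y u - y v) * (y u - y v) ≤ d * d

/-- Both coordinate differences are at most `d / 2`, so the squared distance is at most `d² / 2`. -/
theorem near_of_level_eq {x y : ℕ → ℝ} {d : ℝ} (hd : 0 < d) {n u v : ℕ} (hu : u < n) (hv : v < n)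
    (hx : level x d n u = level x d n v) (hy : level y d n u = level y d n v) :
    Near x y d u v := by
  have h₁ := sub_le_of_level_eq hd hu hx
  have h₂ := sub_le_of_level_eq hd hv hx.symm
  have h₃ := sub_le_of_level_eq hd hu hy
  have h₄ := sub_le_of_level_eq hd hv hy.symm
  unfold Near
  nlinarith

theorem Near.abs_sub_le {x y : ℕ → ℝ} {d : ℝ} (hd : 0 < d) {u v : ℕ} (h : Near x y d u v) :
    |x u - x v| ≤ d ∧ |y u - y v| ≤ d := by
  unfold Near at h
  constructor <;> apply abs_le_of_sq_le_sq _ hd.le <;>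
    nlinarith [mul_self_nonneg (x u - x v), mul_self_nonneg (y u - y v)]

/-- The class of a point in the grid of `K × K` blocks of cells that is shifted by `a`. -/
def blockOf (f g : ℕ → ℕ) (K a i : ℕ) : ℕ × ℕ := ((f i + a) / K, (g i + a) / K)

open Classical in
-- Adding at most 2 passes a multiple of `K` only from the last two residues, and each residue of `m
-- + a` occurs for exactly one `a < K`.
theorem card_shift_separating_le {K m m' : ℕ} (hK : 0 < K) (h₁ : m ≤ m' + 2) (h₂ : m' ≤ m + 2) :
    ((Finset.range K).filter fun a => (m + a) / K ≠ (m' + a) / K).card ≤ 2 := by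
  wlog h : m ≤ m' generalizing m m'
  · have := this h₂ h₁ (by omega)
    simpa only [ne_comm] using this
  have : ((Finset.range K).filter fun a => (m + a) / K ≠ (m' + a) / K).card ≤
      ({K - 1, K - 2} : Finset ℕ).card := by
    refine Finset.card_le_card_of_injOn (fun a => (m + a) % K) ?_ ?_
    · intro a ha
      have ha := (Finset.mem_filter.1 (Finset.mem_coe.1 ha)).2
      have hlt := Nat.mod_lt (m + a) hK
      have hdm := Nat.div_add_mod (m + a) K
      simp only [Finset.coe_insert, Finset.coe_singleton, Set.mem_insert_iff,
        Set.mem_singleton_iff]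
      by_contra hne
      apply ha
      symm
      rw [Nat.div_eq_iff hK]
      have : (m + a) / K * K = K * ((m + a) / K) := Nat.mul_comm _ _
      omega
    · intro a ha b hb hab
      have ha := Finset.mem_range.1 (Finset.mem_filter.1 (Finset.mem_coe.1 ha)).1
      have hb := Finset.mem_range.1 (Finset.mem_filter.1 (Finset.mem_coe.1 hb)).1
      have : (m + a) ≡ (m + b) [MOD K] := hab
      have := Nat.ModEq.add_left_cancel' m this
      exact Nat.ModEq.eq_of_lt_of_lt this ha hb
  exact this.trans Finset.card_le_two

/-! ### Coverage within classes -/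

section Coverage

variable {γ : Type*} (near : ℕ → ℕ → Prop) (c : ℕ → γ) (w : ℕ → ℝ) (n : ℕ)

/-- Some member of `S` of the same class covers `v`. -/
def CoveredIn (S : Finset ℕ) (v : ℕ) : Prop := ∃ u ∈ S, near u v ∧ c u = c v

open Classical in
/-- The weight of all vertices that are covered by a member of `S` of their own class. -/
noncomputable def coverage (S : Finset ℕ) : ℝ :=
  ∑ v ∈ Finset.range n, if CoveredIn near c S v then w v else 0

variable {near c w n}

theorem coverage_mono_of (hw : ∀ i, 0 ≤ w i) {S T : Finset ℕ}
    (h : ∀ v < n, CoveredIn near c S v → CoveredIn near c T v) :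
    coverage near c w n S ≤ coverage near c w n T := by
  refine Finset.sum_le_sum fun v hv => ?_
  have := h v (Finset.mem_range.1 hv)
  split_ifs with h₁ h₂
  · rfl
  · exact absurd (this h₁) h₂
  · exact hw v
  · rfl

theorem coverage_nonneg (hw : ∀ i, 0 ≤ w i) (S : Finset ℕ) : 0 ≤ coverage near c w n S :=
  Finset.sum_nonneg fun v _ => by split_ifs; exacts [hw v, le_rfl]

/-- A vertex counts only if covered from its own class, so vertices of class `b` depend on `D` alone
and all others on `S` alone. This additivity is what makes the dynamic program correct. -/
theorem coverage_union {S D : Finset ℕ} {b : γ} (hS : ∀ i ∈ S, c i ≠ b) (hD : ∀ i ∈ D, c i = b) :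
    coverage near c w n (S ∪ D) = coverage near c w n S + coverage near c w n D := by
  classical
  unfold coverage
  rw [← Finset.sum_add_distrib]
  refine Finset.sum_congr rfl fun v _ => ?_
  by_cases hv : c v = b
  · have h₁ : ¬ CoveredIn near c S v := fun ⟨u, hu, _, h⟩ => hS u hu (h.trans hv)
    have h₂ : CoveredIn near c (S ∪ D) v ↔ CoveredIn near c D v := by
      simp only [CoveredIn, Finset.mem_union]
      exact ⟨fun ⟨u, hu, h⟩ => hu.elim (fun hu => absurd ⟨u, hu, h⟩ h₁) fun hu => ⟨u, hu, h⟩,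
        fun ⟨u, hu, h⟩ => ⟨u, Or.inr hu, h⟩⟩
    rw [if_congr h₂ rfl rfl, if_neg h₁, zero_add]
  · have h₁ : ¬ CoveredIn near c D v := fun ⟨u, hu, _, h⟩ => hv (h.symm.trans (hD u hu))
    have h₂ : CoveredIn near c (S ∪ D) v ↔ CoveredIn near c S v := by
      simp only [CoveredIn, Finset.mem_union]
      exact ⟨fun ⟨u, hu, h⟩ => hu.elim (fun hu => ⟨u, hu, h⟩) fun hu => absurd ⟨u, hu, h⟩ h₁,
        fun ⟨u, hu, h⟩ => ⟨u, Or.inl hu, h⟩⟩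
    rw [if_congr h₂ rfl rfl, if_neg h₁, add_zero]

/-- Every selection within the class `b` can be replaced by one with at most `M` members. -/
def SmallDominators (near : ℕ → ℕ → Prop) (c : ℕ → γ) (w : ℕ → ℝ) (n M : ℕ) (b : γ) : Prop :=
  ∀ T ⊆ Finset.range n, (∀ i ∈ T, c i = b) → ∃ D ⊆ Finset.range n, (∀ i ∈ D, c i = b) ∧
    D.card ≤ M ∧ D.card ≤ T.card ∧ coverage near c w n T ≤ coverage near c w n D

/-- The recursion of the dynamic program: an optimal selection for a set of classes together with
a new class `b` arises from one for the old classes and at most `M` vertices of class `b`. -/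
theorem SmallDominators.exists_extension {M k : ℕ} {b : γ}
    (hb : SmallDominators near c w n M b) {U : ℕ → Prop} (hU : ∀ i, U i → c i ≠ b)
    {T : Finset ℕ} (hT : T ⊆ Finset.range n) (hTU : ∀ i ∈ T, U i ∨ c i = b) (hk : T.card ≤ k) :
    ∃ D ⊆ Finset.range n, ∃ T₀ ⊆ Finset.range n, (∀ i ∈ D, c i = b) ∧ D.card ≤ M ∧ D.card ≤ k ∧
      T₀.card ≤ k - D.card ∧ (∀ i ∈ T₀, U i) ∧
      ∀ S : Finset ℕ, (∀ i ∈ S, U i) → coverage near c w n T₀ ≤ coverage near c w n S →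
        coverage near c w n T ≤ coverage near c w n (S ∪ D) := by
  classical
  obtain ⟨D, hDn, hDb, hDM, hDT, hcov⟩ := hb (T.filter fun i => c i = b)
    ((Finset.filter_subset _ _).trans hT) fun i hi => (Finset.mem_filter.1 hi).2
  have hcard := Finset.card_filter_add_card_filter_not (s := T) fun i => c i = b
  -- The replacement `D` is no larger than the part of `T` in class `b`, so the part outside fits
  -- into the remaining budget `k - D.card`.
  refine ⟨D, hDn, T.filter fun i => ¬ c i = b, (Finset.filter_subset _ _).trans hT, hDb, hDM,
    by omega, by omega, fun i hi => ?_, fun S hS hST => ?_⟩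
  · have hi := Finset.mem_filter.1 hi
    exact (hTU i hi.1).resolve_right hi.2
  · have hTd : T = (T.filter fun i => ¬ c i = b) ∪ T.filter fun i => c i = b := by
      rw [Finset.union_comm, Finset.filter_union_filter_not_eq]
    rw [hTd, coverage_union (b := b) (fun i hi => (Finset.mem_filter.1 hi).2)
      (fun i hi => (Finset.mem_filter.1 hi).2), coverage_union (fun i hi => hU i (hS i hi)) hDb]
    exact add_le_add hST hcov

/-- A block has at most `K * K` occupied cells, and one representative per cell covers every vertex
of the block. A selection that already has at most `K * K` members is kept, which ensures that the
replacement never costs more. -/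
theorem smallDominators_blockOf (hw : ∀ i, 0 ≤ w i) {f g : ℕ → ℕ} {K a : ℕ} (hK : 0 < K)
    (hnear : ∀ u < n, ∀ v < n, f u = f v → g u = g v → near u v) (b : ℕ × ℕ) :
    SmallDominators near (blockOf f g K a) w n (K * K) b := by
  classical
  intro T hT hTb
  rcases le_or_gt T.card (K * K) with hle | hgt
  · exact ⟨T, hT, hTb, hle, le_rfl, le_rfl⟩
  let B := (Finset.range n).filter fun i => blockOf f g K a i = b
  have hex : ∀ q ∈ B.image fun i => (f i, g i), ∃ i ∈ B, (f i, g i) = q := fun q hq =>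
    Finset.mem_image.1 hq
  choose! rep hrepB hrep using hex
  have hcard : ((B.image fun i => (f i, g i)).image rep).card ≤ K * K := by
    refine Finset.card_image_le.trans ?_
    have : (B.image fun i => (f i, g i)).card ≤ (Finset.range K ×ˢ Finset.range K).card := by
      refine Finset.card_le_card_of_injOn (fun q => ((q.1 + a) % K, (q.2 + a) % K)) ?_ ?_
      · intro q _
        simp [Nat.mod_lt _ hK]
      -- Within one block the quotients of the shifted levels agree, so the residues determine the
      -- cell.
      · intro q hq q' hq' he
        obtain ⟨i, hi, rfl⟩ := Finset.mem_image.1 (Finset.mem_coe.1 hq)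
        obtain ⟨j, hj, rfl⟩ := Finset.mem_image.1 (Finset.mem_coe.1 hq')
        have hij := ((Finset.mem_filter.1 hi).2).trans (Finset.mem_filter.1 hj).2.symm
        simp only [blockOf, Prod.mk.injEq] at hij he ⊢
        have e₁ := Nat.div_add_mod (f i + a) K
        have e₂ := Nat.div_add_mod (f j + a) K
        have e₃ := Nat.div_add_mod (g i + a) K
        have e₄ := Nat.div_add_mod (g j + a) K
        rw [hij.1, he.1] at e₁
        rw [hij.2, he.2] at e₃
        omega
    simpa using this
  have hmem : ∀ i ∈ (B.image fun i => (f i, g i)).image rep, i ∈ B := by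
    intro i hi
    obtain ⟨q, hq, rfl⟩ := Finset.mem_image.1 hi
    exact hrepB q hq
  refine ⟨(B.image fun i => (f i, g i)).image rep,
    fun i hi => (Finset.mem_filter.1 (hmem i hi)).1, fun i hi => (Finset.mem_filter.1 (hmem i hi)).2,
    hcard, hcard.trans hgt.le, coverage_mono_of hw ?_⟩
  rintro v hv ⟨u, hu, -, huv⟩
  have hvB : v ∈ B := Finset.mem_filter.2 ⟨Finset.mem_range.2 hv, huv.symm.trans (hTb u hu)⟩
  have hq : (f v, g v) ∈ B.image fun i => (f i, g i) := Finset.mem_image_of_mem _ hvB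
  have hr := hrep _ hq
  have hrB := Finset.mem_filter.1 (hrepB _ hq)
  simp only [Prod.mk.injEq] at hr
  exact ⟨_, Finset.mem_image_of_mem _ hq, hnear _ (Finset.mem_range.1 hrB.1) _ hv hr.1 hr.2,
    hrB.2.trans (Finset.mem_filter.1 hvB).2.symm⟩

/-- Some shift preserves all but a fraction `4 / K` of the coverage. -/
theorem exists_shift_coverage (hw : ∀ i, 0 ≤ w i) {f g : ℕ → ℕ} {K : ℕ} (hK : 0 < K)
    (hf : ∀ u v, near u v → f u ≤ f v + 2 ∧ f v ≤ f u + 2)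
    (hg : ∀ u v, near u v → g u ≤ g v + 2 ∧ g v ≤ g u + 2) (T : Finset ℕ) :
    ∃ a < K, (1 - 4 / (K : ℝ)) * coverage near (fun _ => ()) w n T ≤
      coverage near (blockOf f g K a) w n T := by
  classical
  by_contra! hlt
  have hKr : (0 : ℝ) < K := Nat.cast_pos.2 hK
  have hsum : ∑ a ∈ Finset.range K, coverage near (blockOf f g K a) w n T <
      ∑ _a ∈ Finset.range K, (1 - 4 / (K : ℝ)) * coverage near (fun _ => ()) w n T :=
    Finset.sum_lt_sum_of_nonempty ⟨0, Finset.mem_range.2 hK⟩ fun a ha =>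
      hlt a (Finset.mem_range.1 ha)
  rw [Finset.sum_const, Finset.card_range, nsmul_eq_mul, ← mul_assoc, mul_sub, mul_one,
    mul_div_cancel₀ _ hKr.ne'] at hsum
  refine absurd hsum (not_lt.2 ?_)
  unfold coverage
  rw [Finset.sum_comm, Finset.mul_sum]
  refine Finset.sum_le_sum fun v _ => ?_
  by_cases hv : CoveredIn near (fun _ => ()) T v
  · rw [if_pos hv]
    obtain ⟨u, hu, huv, -⟩ := hv
    -- After exchanging the sums it is enough to treat one covered vertex `v`: a fixed neighbor `u`
    -- in `T` stays in its block for all but 2 + 2 shifts.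
    suffices h : (K : ℝ) - 4 ≤ ((Finset.range K).filter fun a =>
        CoveredIn near (blockOf f g K a) T v).card by
      refine (mul_le_mul_of_nonneg_right h (hw v)).trans (le_of_eq ?_)
      rw [← nsmul_eq_mul, ← Finset.sum_const, Finset.sum_filter]
    let A := (Finset.range K).filter fun a => (f u + a) / K ≠ (f v + a) / K
    let A' := (Finset.range K).filter fun a => (g u + a) / K ≠ (g v + a) / K
    have hA : A.card ≤ 2 := card_shift_separating_le hK (hf u v huv).1 (hf u v huv).2
    have hA' : A'.card ≤ 2 := card_shift_separating_le hK (hg u v huv).1 (hg u v huv).2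
    have hsub : Finset.range K ⊆ ((Finset.range K).filter fun a =>
        CoveredIn near (blockOf f g K a) T v) ∪ (A ∪ A') := by
      intro a ha
      by_cases h₁ : (f u + a) / K = (f v + a) / K
      · by_cases h₂ : (g u + a) / K = (g v + a) / K
        · exact Finset.mem_union_left _ (Finset.mem_filter.2 ⟨ha, u, hu, huv, by
            simp [blockOf, h₁, h₂]⟩)
        · exact Finset.mem_union_right _ (Finset.mem_union_right _ (Finset.mem_filter.2 ⟨ha, h₂⟩))
      · exact Finset.mem_union_right _ (Finset.mem_union_left _ (Finset.mem_filter.2 ⟨ha, h₁⟩))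
    have hc := (Finset.card_le_card hsub).trans (Finset.card_union_le _ _)
    have hc' := Finset.card_union_le A A'
    rw [Finset.card_range] at hc
    have : K ≤ ((Finset.range K).filter fun a =>
        CoveredIn near (blockOf f g K a) T v).card + 4 := by omega
    have : (K : ℝ) ≤ ((Finset.range K).filter fun a =>
        CoveredIn near (blockOf f g K a) T v).card + 4 := by exact_mod_cast this
    linarith
  · rw [if_neg hv, mul_zero]
    exact Finset.sum_nonneg fun a _ => by split_ifs; exacts [hw v, le_rfl]

end Coverage

/-! ### The program -/

namespace RealRAM

attribute [simp] Prog.WritesNReg Prog.WritesNArr Prog.WritesRReg Prog.WritesRArr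

/-- Input data of the program, a grid size and what is known about them. -/
structure Scene where
  n : ℕ
  K : ℕ
  d : ℝ
  x : ℕ → ℝ
  y : ℕ → ℝ
  w : ℕ → ℝ
  K_pos : 0 < K
  d_pos : 0 < d
  w_nonneg : ∀ i, 0 ≤ w i

namespace Scene

/-- The class of vertex `i` for the shift `a`. -/
noncomputable def cls (D : Scene) (a i : ℕ) : ℕ × ℕ :=
  blockOf (level D.x D.d D.n) (level D.y D.d D.n) D.K a i

/-- The coverage within classes for the shift `a`. -/
noncomputable def cov (D : Scene) (a : ℕ) (S : Finset ℕ) : ℝ :=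
  coverage (Near D.x D.y D.d) (D.cls a) D.w D.n S

end Scene

/-- The store holds the input data, the two arrays of levels and the tables of quotients by `K`
and of multiples of `n`. -/
structure Env (D : Scene) (s : Store) : Prop where
  n : s.nreg 0 = D.n
  d : s.rreg 0 = D.d
  x : s.rarr 0 = D.x
  y : s.rarr 1 = D.y
  w : s.rarr 2 = D.w
  lx : ∀ i < D.n, s.narr 1 i = level D.x D.d D.n i
  ly : ∀ i < D.n, s.narr 2 i = level D.y D.d D.n i
  div : ∀ j < D.n + D.K, s.narr 3 j = j / D.K
  mul : ∀ k ≤ D.n, s.narr 4 k = k * D.n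
  zero : ∀ j, s.narr 7 j = 0

/-- The program does not write to the memory that `Env` describes. -/
structure Prog.Static (p : Prog) : Prop where
  nreg : ¬ p.WritesNReg 0
  rreg : ¬ p.WritesRReg 0
  rarr₀ : ¬ p.WritesRArr 0
  rarr₁ : ¬ p.WritesRArr 1
  rarr₂ : ¬ p.WritesRArr 2
  narr₁ : ¬ p.WritesNArr 1
  narr₂ : ¬ p.WritesNArr 2
  narr₃ : ¬ p.WritesNArr 3
  narr₄ : ¬ p.WritesNArr 4
  narr₇ : ¬ p.WritesNArr 7

theorem Env.frame {D : Scene} {p : Prog} {s s' : Store} (h : Env D s) (hf : Frame p s s')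
    (hp : p.Static) : Env D s' where
  n := (hf.nreg 0 hp.nreg).trans h.n
  d := (hf.rreg 0 hp.rreg).trans h.d
  x := (hf.rarr 0 hp.rarr₀).trans h.x
  y := (hf.rarr 1 hp.rarr₁).trans h.y
  w := (hf.rarr 2 hp.rarr₂).trans h.w
  lx := by rw [hf.narr 1 hp.narr₁]; exact h.lx
  ly := by rw [hf.narr 2 hp.narr₂]; exact h.ly
  div := by rw [hf.narr 3 hp.narr₃]; exact h.div
  mul := by rw [hf.narr 4 hp.narr₄]; exact h.mul
  zero := by rw [hf.narr 7 hp.narr₇]; exact h.zero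

theorem Env.setNReg {D : Scene} {s : Store} (h : Env D s) {x v : ℕ} (hx : x ≠ 0) :
    Env D (s.setNReg x v) :=
  ⟨by simp [Store.setNReg, Function.update_of_ne hx.symm, h.n], h.d, h.x, h.y, h.w, h.lx, h.ly,
    h.div, h.mul, h.zero⟩

/-- The set stored in the `n` entries from `off` on of the natural number array `a`. -/
def setAt (n : ℕ) (s : Store) (a off : ℕ) : Finset ℕ :=
  (Finset.range n).filter fun i => s.narr a (off + i) ≠ 0

/-- Copy `n` entries of the array `b` from position `f` on to position `e` of the array `a`. -/
def copyLoop (a b : ℕ) (e f : NExpr) : Prog :=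
  forN 6 (.reg 0) (.nput a (.add e (.reg 6)) (.get b (.add f (.reg 6))))

theorem reach_copyLoop {n a b p q k : ℕ} {e f : NExpr} {s : Store} (hab : b ≠ a)
    (hn : s.nreg 0 = n) (he : ∀ s', Frame (copyLoop a b e f) s s' → e.val s' = p)
    (hf : ∀ s', Frame (copyLoop a b e f) s s' → f.val s' = q)
    (hc : e.cost + f.cost ≤ 10) (hk : 11 ≤ k) :
    Reach n (copyLoop a b e f) s k fun s' => ∀ j, s'.narr a j =
      if p ≤ j ∧ j < p + n then s.narr b (q + (j - p)) else s.narr a j := by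
  refine Reach.forN (j := 1) (k := 4) n (fun i s' => ∀ j, s'.narr a j =
    if p ≤ j ∧ j < p + i then s.narr b (q + (j - p)) else s.narr a j) (by simp)
    (by simp [NExpr.cost]) hk ?_ (fun _ _ _ h => h) (by simp) ?_ ?_
  · intro s' h
    simpa [NExpr.val, hn] using h.nreg 0 (by simp)
  · intro j
    rw [if_neg (by omega)]
  · intro i hi s' h hx hI
    refine Reach.nput (by simp [NExpr.cost]; omega) ?_
    have hb : s'.narr b = s.narr b := h.narr b (by simpa using hab)
    intro j
    simp only [NExpr.val, he s' h, hf s' h, hx, Store.setNArr, Function.update_self, hb]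
    rw [Function.update_apply]
    split_ifs with h₁ h₂ h₂
    · subst h₁; simp
    · omega
    · rw [hI, if_pos (by omega)]
    · rw [hI, if_neg (by omega)]

/-- Equality of natural numbers. -/
def eqTest (e f : NExpr) : BExpr := .and (.nle e f) (.nle f e)

theorem holds_eqTest {e f : NExpr} {s : Store} : (eqTest e f).holds s ↔ e.val s = f.val s := by
  simp only [eqTest, BExpr.holds]; omega

/-- The vertices in the registers `u` and `v` are at distance at most `d`. -/
def nearTest (u v : ℕ) : BExpr :=
  .rle (.add (.mul (.sub (.get 0 (.reg u)) (.get 0 (.reg v)))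
        (.sub (.get 0 (.reg u)) (.get 0 (.reg v))))
      (.mul (.sub (.get 1 (.reg u)) (.get 1 (.reg v)))
        (.sub (.get 1 (.reg u)) (.get 1 (.reg v)))))
    (.mul (.reg 0) (.reg 0))

theorem Env.holds_nearTest {D : Scene} {s : Store} (h : Env D s) {u v : ℕ} :
    (nearTest u v).holds s ↔ Near D.x D.y D.d (s.nreg u) (s.nreg v) := by
  simp only [nearTest, BExpr.holds, RExpr.val, NExpr.val, h.x, h.y, h.d, Near]

/-- The vertices in the registers `u` and `v` have the same class for the shift in register 2. -/
def sameTest (u v : ℕ) : BExpr :=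
  .and (eqTest (.get 3 (.add (.get 1 (.reg u)) (.reg 2))) (.get 3 (.add (.get 1 (.reg v)) (.reg 2))))
    (eqTest (.get 3 (.add (.get 2 (.reg u)) (.reg 2))) (.get 3 (.add (.get 2 (.reg v)) (.reg 2))))

/-- The index is a level, below `n`, plus a shift, below `K`; so it lies within the `n + K` valid
entries of the table of quotients. -/
theorem Env.holds_sameTest {D : Scene} {s : Store} (h : Env D s) {u v a : ℕ} (ha : s.nreg 2 = a)
    (haK : a < D.K) (hu : s.nreg u < D.n) (hv : s.nreg v < D.n) :
    (sameTest u v).holds s ↔ D.cls a (s.nreg u) = D.cls a (s.nreg v) := by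
  have h₁ := level_lt (x := D.x) D.d_pos hu
  have h₂ := level_lt (x := D.x) D.d_pos hv
  have h₃ := level_lt (x := D.y) D.d_pos hu
  have h₄ := level_lt (x := D.y) D.d_pos hv
  rw [sameTest, BExpr.holds, holds_eqTest, holds_eqTest]
  simp only [NExpr.val, ha, h.lx _ hu, h.lx _ hv, h.ly _ hu, h.ly _ hv]
  rw [h.div _ (by omega), h.div _ (by omega), h.div _ (by omega), h.div _ (by omega)]
  simp [Scene.cls, blockOf]

/-- Add the vertices of the class of register 3 in the registers `101, …, 100 + m` to the
candidate. -/
def mark : ℕ → Prog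
  | 0 => .nop
  | m + 1 => .seq (mark m) (.cond (sameTest (101 + m) 3) (.nput 6 (.reg (101 + m)) (.const 1)) .nop)

@[simp] theorem writesNReg_mark {m y : ℕ} : ¬ (mark m).WritesNReg y := by
  induction m <;> simp_all [mark]

@[simp] theorem writesNArr_mark {m y : ℕ} (h : y ≠ 6) : ¬ (mark m).WritesNArr y := by
  induction m <;> simp_all [mark]

@[simp] theorem writesRReg_mark {m y : ℕ} : ¬ (mark m).WritesRReg y := by
  induction m <;> simp_all [mark]

@[simp] theorem writesRArr_mark {m y : ℕ} : ¬ (mark m).WritesRArr y := by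
  induction m <;> simp_all [mark]

theorem static_mark (m : ℕ) : (mark m).Static := by constructor <;> simp

theorem reach_mark {D : Scene} {s : Store} (h : Env D s) {a r : ℕ} (ha : s.nreg 2 = a)
    (haK : a < D.K) (hr : s.nreg 3 = r) (hrn : r < D.n) (m : ℕ) :
    Reach D.n (mark m) s (m + 8) fun s' => ∀ i < D.n, s'.narr 6 i ≠ 0 ↔
      s.narr 6 i ≠ 0 ∨ ∃ j < m, s.nreg (101 + j) = i ∧ D.cls a i = D.cls a r := by
  induction m with
  | zero => exact Reach.nop (by simp)
  | succ m ih =>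
    refine Reach.seq (j := 7) ih (fun s' hf hI => ?_) (by omega) (by omega)
    have h' := h.frame hf (static_mark m)
    have hreg : ∀ x, s'.nreg x = s.nreg x := fun x => hf.nreg x (by simp)
    -- A register may also hold `n`, which names no vertex. The test is then meaningless, but a
    -- write to entry `n` lies outside the candidate.
    have hiff : s.nreg (101 + m) < D.n → ((sameTest (101 + m) 3).holds s' ↔
        D.cls a (s.nreg (101 + m)) = D.cls a r) := fun hlt => by
      rw [h'.holds_sameTest ((hreg 2).trans ha) haK (by rwa [hreg]) (by rwa [hreg, hr]), hreg,
        hreg, hr]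
    have hex : ∀ i, (∃ j < m + 1, s.nreg (101 + j) = i ∧ D.cls a i = D.cls a r) ↔
        (∃ j < m, s.nreg (101 + j) = i ∧ D.cls a i = D.cls a r) ∨
          s.nreg (101 + m) = i ∧ D.cls a i = D.cls a r := by
      intro i
      constructor
      · rintro ⟨j, hj, hji⟩
        rcases Nat.lt_succ_iff_lt_or_eq.1 hj with hj | rfl
        · exact Or.inl ⟨j, hj, hji⟩
        · exact Or.inr hji
      · rintro (⟨j, hj, hji⟩ | hji)
        · exact ⟨j, by omega, hji⟩
        · exact ⟨m, by omega, hji⟩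
    refine Reach.cond (i := 6) (j := 2) (by simp [BExpr.cost, NExpr.cost, sameTest, eqTest])
      (fun hb => Reach.nput (by simp [NExpr.cost]) fun i hi => ?_)
      (fun hb => Reach.nop fun i hi => ?_) (by omega) (by omega)
    · simp only [Store.setNArr, NExpr.val, hreg, Function.update_self, Function.update_apply]
      rw [hex]
      split_ifs with he
      · subst he
        simp [(hiff hi).1 hb]
      · have : ¬ (s.nreg (101 + m) = i ∧ D.cls a i = D.cls a r) := fun h' => he h'.1.symm
        rw [hI i hi, or_iff_left this]
    · rw [hex, hI i hi]
      have : ¬ (s.nreg (101 + m) = i ∧ D.cls a i = D.cls a r) := by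
        rintro ⟨rfl, h'⟩
        exact hb ((hiff hi).2 h')
      rw [or_iff_left this]

/-- Count the members of the candidate. -/
def countLoop : Prog :=
  .seq (.nset 8 (.const 0)) (forN 6 (.reg 0)
    (.cond (.nle (.const 1) (.get 6 (.reg 6))) (.nset 8 (.add (.reg 8) (.const 1))) .nop))

theorem reach_countLoop {n : ℕ} {s : Store} (hn : s.nreg 0 = n) :
    Reach n countLoop s 12 fun s' => s'.nreg 8 = (setAt n s 6 0).card := by
  refine Reach.seq (i := 1) (R := fun s' => s'.nreg 8 = 0) (Reach.nset (by simp [NExpr.cost])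
    (by simp [Store.setNReg, NExpr.val])) (fun s₁ hf₁ h₁ => ?_) (by omega) (lt_add_one 11)
  have hn₁ : s₁.nreg 0 = n := (hf₁.nreg 0 (by simp)).trans hn
  have hc₁ : s₁.narr 6 = s.narr 6 := hf₁.narr 6 (by simp)
  refine Reach.forN (j := 1) (k := 4) n (fun i s' => s'.nreg 8 =
    ((Finset.range i).filter fun i => s.narr 6 (0 + i) ≠ 0).card) (by simp)
    (by simp [NExpr.cost]) (by simp) ?_ (fun i s' v h => by simpa [Store.setNReg] using h)
    (by simp) (by simpa using h₁) ?_
  · intro s' h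
    simpa [NExpr.val, hn₁] using h.nreg 0 (by simp)
  · intro i hi s' hf hx hI
    have hc : s'.narr 6 = s.narr 6 := (hf.narr 6 (by simp)).trans hc₁
    refine Reach.cond (i := 3) (j := 2) (by simp [BExpr.cost, NExpr.cost])
      (fun hb => Reach.nset (by simp [NExpr.cost]) ?_) (fun hb => Reach.nop ?_)
      (by omega) (by omega)
    · have hb : s.narr 6 (0 + i) ≠ 0 := by
        simp only [BExpr.holds, NExpr.val, hx, hc] at hb
        rw [zero_add]; omega
      rw [Finset.range_add_one, Finset.filter_insert, if_pos hb, Finset.card_insert_of_notMem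
        (by simp), ← hI]
      simp [Store.setNReg, NExpr.val]
    · have hb : ¬ s.narr 6 (0 + i) ≠ 0 := by
        simp only [BExpr.holds, NExpr.val, hx, hc] at hb
        rw [zero_add]; omega
      rw [Finset.range_add_one, Finset.filter_insert, if_neg hb, ← hI]

/-- Determine whether the vertex in register 6 is covered by the candidate. -/
def coveredLoop : Prog :=
  .seq (.nset 9 (.const 0)) (forN 7 (.reg 0)
    (.cond (.and (.nle (.const 1) (.get 6 (.reg 7))) (.and (nearTest 7 6) (sameTest 7 6)))
      (.nset 9 (.const 1)) .nop))

theorem static_coveredLoop : coveredLoop.Static := by constructor <;> simp [coveredLoop]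

theorem reach_coveredLoop {D : Scene} {s : Store} (h : Env D s) {a v : ℕ} (ha : s.nreg 2 = a)
    (haK : a < D.K) (hv : s.nreg 6 = v) (hvn : v < D.n) :
    Reach D.n coveredLoop s 17 fun s' => s'.nreg 9 ≠ 0 ↔
      CoveredIn (Near D.x D.y D.d) (D.cls a) (setAt D.n s 6 0) v := by
  refine Reach.seq (i := 1) (R := fun s' => s'.nreg 9 = 0) (Reach.nset (by simp [NExpr.cost])
    (by simp [Store.setNReg, NExpr.val])) (fun s₁ hf₁ h₁ => ?_) (by omega) (lt_add_one 16)
  have hE₁ : Env D s₁ := h.frame hf₁ (by constructor <;> simp)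
  have hc₁ : s₁.narr 6 = s.narr 6 := hf₁.narr 6 (by simp)
  have ha₁ : s₁.nreg 2 = a := (hf₁.nreg 2 (by simp)).trans ha
  have hv₁ : s₁.nreg 6 = v := (hf₁.nreg 6 (by simp)).trans hv
  refine (Reach.forN (j := 1) (k := 8) (k' := 15) D.n (fun i s' => s'.nreg 9 ≠ 0 ↔ ∃ u < i,
    s.narr 6 u ≠ 0 ∧ Near D.x D.y D.d u v ∧ D.cls a u = D.cls a v) (by simp)
    (by simp [NExpr.cost]) (by simp) ?_ (fun i s' v h => by simpa [Store.setNReg] using h)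
    (by simp) (by simpa using h₁) ?_).imp (by omega) ?_
  · intro s' h
    simpa [NExpr.val, hE₁.n] using h.nreg 0 (by simp)
  · intro i hi s' hf hx hI
    have hE : Env D s' := hE₁.frame hf (by constructor <;> simp)
    have hc : s'.narr 6 = s.narr 6 := (hf.narr 6 (by simp)).trans hc₁
    have ha' : s'.nreg 2 = a := (hf.nreg 2 (by simp)).trans ha₁
    have hv' : s'.nreg 6 = v := (hf.nreg 6 (by simp)).trans hv₁
    have hiff : (BExpr.and (.nle (.const 1) (.get 6 (.reg 7)))
        (.and (nearTest 7 6) (sameTest 7 6))).holds s' ↔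
        s.narr 6 i ≠ 0 ∧ Near D.x D.y D.d i v ∧ D.cls a i = D.cls a v := by
      rw [BExpr.holds, BExpr.holds, BExpr.holds, hE.holds_nearTest,
        hE.holds_sameTest ha' haK (by rwa [hx]) (by rwa [hv']), hx, hv']
      simp only [NExpr.val, hx, hc]
      rw [Nat.one_le_iff_ne_zero]
    have hex : (∃ u < i + 1, s.narr 6 u ≠ 0 ∧ Near D.x D.y D.d u v ∧ D.cls a u = D.cls a v) ↔
        (∃ u < i, s.narr 6 u ≠ 0 ∧ Near D.x D.y D.d u v ∧ D.cls a u = D.cls a v) ∨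
        s.narr 6 i ≠ 0 ∧ Near D.x D.y D.d i v ∧ D.cls a i = D.cls a v := by
      constructor
      · rintro ⟨u, hu, h'⟩
        rcases Nat.lt_succ_iff_lt_or_eq.1 hu with hu | rfl
        · exact Or.inl ⟨u, hu, h'⟩
        · exact Or.inr h'
      · rintro (⟨u, hu, h'⟩ | h')
        · exact ⟨u, by omega, h'⟩
        · exact ⟨i, by omega, h'⟩
    refine Reach.cond (i := 7) (j := 2)
      (by simp [BExpr.cost, NExpr.cost, RExpr.cost, nearTest, sameTest, eqTest])
      (fun hb => Reach.nset (by simp [NExpr.cost]) ?_) (fun hb => Reach.nop ?_)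
      (by omega) (by omega)
    · rw [hex]
      simp [Store.setNReg, NExpr.val, hiff.1 hb]
    · rw [hex, hI, or_iff_left (hiff.not.1 hb)]
  · intro s' _ hI
    rw [hI]
    simp only [CoveredIn, setAt, Finset.mem_filter, Finset.mem_range, zero_add, and_assoc]

/-- Compute the coverage of the candidate. -/
def valueLoop : Prog :=
  .seq (.rset 1 (.const 0)) (forN 6 (.reg 0) (.seq coveredLoop
    (.cond (.nle (.const 1) (.reg 9)) (.rset 1 (.add (.reg 1) (.get 2 (.reg 6)))) .nop)))

theorem reach_valueLoop {D : Scene} {s : Store} (h : Env D s) {a : ℕ} (ha : s.nreg 2 = a)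
    (haK : a < D.K) :
    Reach D.n valueLoop s 26 fun s' => s'.rreg 1 = D.cov a (setAt D.n s 6 0) := by
  classical
  refine Reach.seq (i := 1) (R := fun s' => s'.rreg 1 = 0) (Reach.rset (by simp [RExpr.cost])
    (by simp [Store.setRReg, RExpr.val])) (fun s₁ hf₁ h₁ => ?_) (by omega) (lt_add_one 25)
  have hE₁ : Env D s₁ := h.frame hf₁ (by constructor <;> simp)
  have hc₁ : s₁.narr 6 = s.narr 6 := hf₁.narr 6 (by simp)
  have ha₁ : s₁.nreg 2 = a := (hf₁.nreg 2 (by simp)).trans ha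
  refine (Reach.forN (j := 1) (k := 18) D.n (fun i s' => s'.rreg 1 = ∑ v ∈ Finset.range i,
    if CoveredIn (Near D.x D.y D.d) (D.cls a) (setAt D.n s 6 0) v then D.w v else 0) (by simp)
    (by simp [NExpr.cost]) (by simp) ?_ (fun i s' v h => h)
    (by simp [coveredLoop]) (by simpa using h₁) ?_).imp le_rfl fun s' _ hI => hI
  · intro s' h
    simpa [NExpr.val, hE₁.n] using h.nreg 0 (by simp [coveredLoop])
  · intro i hi s' hf hx hI
    have hE : Env D s' := hE₁.frame hf (by constructor <;> simp [coveredLoop])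
    have hc : s'.narr 6 = s.narr 6 := (hf.narr 6 (by simp [coveredLoop])).trans hc₁
    have ha' : s'.nreg 2 = a := (hf.nreg 2 (by simp [coveredLoop])).trans ha₁
    have hset : setAt D.n s' 6 0 = setAt D.n s 6 0 := by simp only [setAt, hc]
    refine Reach.seq (reach_coveredLoop hE ha' haK hx hi) (fun s₂ hf₂ h₂ => ?_) (lt_add_one 17)
      (show 5 < 18 by omega)
    rw [hset] at h₂
    have hr : s₂.rreg 1 = s'.rreg 1 := hf₂.rreg 1 (by simp [coveredLoop])
    have hx₂ : s₂.nreg 6 = i := (hf₂.nreg 6 (by simp [coveredLoop])).trans hx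
    have hw₂ : s₂.rarr 2 = D.w := (hE.frame hf₂ static_coveredLoop).w
    have hb : (BExpr.nle (.const 1) (.reg 9)).holds s₂ ↔ s₂.nreg 9 ≠ 0 := by
      simp only [BExpr.holds, NExpr.val]; omega
    rw [h₂] at hb
    refine Reach.cond (i := 3) (j := 3) (by simp [BExpr.cost, NExpr.cost])
      (fun hb' => Reach.rset (by simp [NExpr.cost, RExpr.cost]) ?_) (fun hb' => Reach.nop ?_)
      (by omega) (by omega)
    · rw [Finset.sum_range_succ, if_pos (hb.1 hb'), ← hI]
      simp [Store.setRReg, RExpr.val, NExpr.val, hr, hx₂, hw₂]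
    · rw [Finset.sum_range_succ, if_neg (hb.not.1 hb'), ← hI, hr, add_zero]

end RealRAM

/-! ### The table of the dynamic program and its improvement by candidates -/

namespace RealRAM

/-- The selection in row `q` of the table of the dynamic program. -/
def row (D : Scene) (s : Store) (q : ℕ) : Finset ℕ := setAt D.n s 5 (q * D.n)

open Classical in
/-- The vertices of the class of `r` among `τ 0, …, τ (M - 1)`. -/
noncomputable def marked (D : Scene) (a r M : ℕ) (τ : ℕ → ℕ) : Finset ℕ :=
  (Finset.range D.n).filter fun i => ∃ j < M, τ j = i ∧ D.cls a i = D.cls a r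

/-- Write the candidate into row `k` if it has at most `k` members and is not worse. -/
def accept : Prog :=
  .cond (.and (.nle (.reg 8) (.reg 5)) (.rle (.get 3 (.reg 5)) (.reg 1)))
    (.seq (.rput 3 (.reg 5) (.reg 1)) (copyLoop 5 6 (.get 4 (.reg 5)) (.const 0))) .nop

/-- Row `q` is the same in both stores. -/
def SameRow (D : Scene) (s s' : Store) (q : ℕ) : Prop :=
  row D s' q = row D s q ∧ s'.rarr 3 q = s.rarr 3 q

theorem reach_accept {D : Scene} {s : Store} (h : Env D s) {k : ℕ} (hk : s.nreg 5 = k)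
    (hkn : k ≤ D.n) :
    Reach D.n accept s 13 fun s' => (∀ q, q ≠ k → SameRow D s s' q) ∧
      if s.nreg 8 ≤ k ∧ s.rarr 3 k ≤ s.rreg 1 then
        row D s' k = setAt D.n s 6 0 ∧ s'.rarr 3 k = s.rreg 1
      else SameRow D s s' k := by
  have hb : (BExpr.and (.nle (.reg 8) (.reg 5)) (.rle (.get 3 (.reg 5)) (.reg 1))).holds s ↔
      s.nreg 8 ≤ k ∧ s.rarr 3 k ≤ s.rreg 1 := by
    simp only [BExpr.holds, NExpr.val, RExpr.val, hk]
  refine Reach.cond (i := 4) (j := 12) (by simp [BExpr.cost, NExpr.cost, RExpr.cost])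
    (fun hb' => ?_) (fun hb' => Reach.nop ?_) (by omega) (by omega)
  · simp only [if_pos (hb.1 hb')]
    refine Reach.seq (i := 2) (R := fun s' => s'.rarr 3 = Function.update (s.rarr 3) k (s.rreg 1))
      (Reach.rput (by simp [NExpr.cost, RExpr.cost])
      (by simp [Store.setRArr, NExpr.val, RExpr.val, hk]))
      (fun s₁ hf₁ h₁ => ?_) (by omega) (lt_add_one 11)
    have hE₁ : Env D s₁ := h.frame hf₁ (by constructor <;> simp)
    have hk₁ : s₁.nreg 5 = k := (hf₁.nreg 5 (by simp)).trans hk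
    have h5 : s₁.narr 5 = s.narr 5 := hf₁.narr 5 (by simp)
    have h6 : s₁.narr 6 = s.narr 6 := hf₁.narr 6 (by simp)
    refine (reach_copyLoop (p := k * D.n) (q := 0) (by omega) hE₁.n (fun s' hf => ?_)
      (fun s' hf => rfl) (by simp [NExpr.cost]) le_rfl).imp le_rfl fun s' hf hs' => ?_
    · have e₁ : s'.nreg 5 = k := (hf.nreg 5 (by simp [copyLoop])).trans hk₁
      have e₂ : s'.narr 4 = s₁.narr 4 := hf.narr 4 (by simp [copyLoop])
      simp [NExpr.val, e₁, e₂, hE₁.mul k hkn]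
    have hF : s'.rarr 3 = s₁.rarr 3 := hf.rarr 3 (by simp [copyLoop])
    refine ⟨fun q hq => ⟨?_, ?_⟩, ?_, ?_⟩
    · refine Finset.filter_congr fun i hi => ?_
      have hi := Finset.mem_range.1 hi
      rw [hs', if_neg, h5]
      rintro ⟨g₁, g₂⟩
      apply hq
      -- Rows are disjoint segments of length `n`: the quotient of a position by `n` recovers its
      -- row.
      have e : (q * D.n + i) / D.n = q := by
        rw [Nat.div_eq_iff (by omega)]; constructor <;> omega
      have e' : (q * D.n + i) / D.n = k := by
        rw [Nat.div_eq_iff (by omega)]; constructor <;> omega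
      omega
    · rw [hF, h₁, Function.update_of_ne hq]
    · refine Finset.filter_congr fun i hi => ?_
      have hi := Finset.mem_range.1 hi
      rw [hs', if_pos (by omega), h6, Nat.add_sub_cancel_left]
    · rw [hF, h₁, Function.update_self]
  · rw [if_neg (hb.not.1 hb')]
    exact ⟨fun _ _ => ⟨rfl, rfl⟩, rfl, rfl⟩

/-- Try to improve row `k` (in register 5) by row `k'` (in register 100) together with the members
of the current class among the vertices in the registers from 101 on. -/
def tryCand (M : ℕ) : Prog :=
  .seq (copyLoop 6 5 (.const 0) (.get 4 (.reg 100)))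
    (.seq (mark M) (.seq countLoop (.seq valueLoop accept)))

/-- Size and coverage are recomputed from the candidate itself. A candidate built on an unsuitable
row is therefore harmless: it is rejected or stored with its correct value. -/
theorem reach_tryCand {D : Scene} {s : Store} (h : Env D s) {M a r k k' : ℕ} (ha : s.nreg 2 = a)
    (haK : a < D.K) (hr : s.nreg 3 = r) (hrn : r < D.n) (hk : s.nreg 5 = k) (hkn : k ≤ D.n)
    (hk' : s.nreg 100 = k') (hkn' : k' ≤ D.n) {C : Finset ℕ}
    (hC : C = row D s k' ∪ marked D a r M fun j => s.nreg (101 + j)) :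
    Reach D.n (tryCand M) s (M + 40) fun s' => (∀ q, q ≠ k → SameRow D s s' q) ∧
      if C.card ≤ k ∧ s.rarr 3 k ≤ D.cov a C then row D s' k = C ∧ s'.rarr 3 k = D.cov a C
      else SameRow D s s' k := by
  classical
  refine Reach.seq (j := M + 39) (reach_copyLoop (p := 0) (q := k' * D.n) (by omega) h.n
    (fun s' hf => rfl) (fun s' hf => ?_) (by simp [NExpr.cost]) le_rfl) (fun s₁ hf₁ h₁ => ?_)
    (by omega) (by omega)
  · have e₁ : s'.nreg 100 = k' := (hf.nreg 100 (by simp [copyLoop])).trans hk'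
    have e₂ : s'.narr 4 = s.narr 4 := hf.narr 4 (by simp [copyLoop])
    simp [NExpr.val, e₁, e₂, h.mul k' hkn']
  have hE₁ := h.frame hf₁ (by constructor <;> simp [copyLoop])
  have g₁ : ∀ x, x ≠ 6 → s₁.nreg x = s.nreg x := fun x hx => hf₁.nreg x (by simp [copyLoop, hx])
  refine Reach.seq (i := M + 8) (j := M + 38) (reach_mark hE₁ ((g₁ 2 (by omega)).trans ha) haK
    ((g₁ 3 (by omega)).trans hr) hrn M) (fun s₂ hf₂ h₂ => ?_) (by omega) (by omega)
  have hE₂ := hE₁.frame hf₂ (static_mark M)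
  have g₂ : ∀ x, x ≠ 6 → s₂.nreg x = s.nreg x := fun x hx =>
    (hf₂.nreg x (by simp)).trans (g₁ x hx)
  have hset : setAt D.n s₂ 6 0 = C := by
    rw [hC]
    ext i
    simp only [setAt, row, marked, Finset.mem_union, Finset.mem_filter, Finset.mem_range, zero_add]
    rw [← and_or_left]
    refine and_congr_right fun hi => ?_
    have e : ∀ j, s₁.nreg (101 + j) = s.nreg (101 + j) := fun j => g₁ _ (by omega)
    simp only [h₂ i hi, h₁, e]
    rw [if_pos (by omega), Nat.sub_zero]
  refine Reach.seq (i := 12) (j := M + 37) (reach_countLoop hE₂.n) (fun s₃ hf₃ h₃ => ?_)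
    (by omega) (by omega)
  have hE₃ := hE₂.frame hf₃ (by constructor <;> simp [countLoop])
  have hset₃ : setAt D.n s₃ 6 0 = C := by
    rw [← hset, setAt, setAt, hf₃.narr 6 (by simp [countLoop])]
  refine Reach.seq (i := 26) (j := 13) (reach_valueLoop hE₃
    ((hf₃.nreg 2 (by simp [countLoop])).trans ((g₂ 2 (by omega)).trans ha)) haK)
    (fun s₄ hf₄ h₄ => ?_) (by omega) (by omega)
  have hE₄ := hE₃.frame hf₄ (by constructor <;> simp [valueLoop, coveredLoop])
  have hset₄ : setAt D.n s₄ 6 0 = C := by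
    rw [← hset₃, setAt, setAt, hf₄.narr 6 (by simp [valueLoop, coveredLoop])]
  have hk₄ : s₄.nreg 5 = k := (hf₄.nreg 5 (by simp [valueLoop, coveredLoop])).trans
    ((hf₃.nreg 5 (by simp [countLoop])).trans ((g₂ 5 (by omega)).trans hk))
  have e₁ : s₄.nreg 8 = C.card := by
    rw [hf₄.nreg 8 (by simp [valueLoop, coveredLoop]), h₃, hset]
  have e₂ : s₄.rreg 1 = D.cov a C := by rw [h₄, hset₃]
  have e₃ : s₄.narr 5 = s.narr 5 := by
    rw [hf₄.narr 5 (by simp [valueLoop, coveredLoop]), hf₃.narr 5 (by simp [countLoop]),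
      hf₂.narr 5 (by simp), hf₁.narr 5 (by simp [copyLoop])]
  have e₄ : s₄.rarr 3 = s.rarr 3 := by
    rw [hf₄.rarr 3 (by simp [valueLoop, coveredLoop]), hf₃.rarr 3 (by simp [countLoop]),
      hf₂.rarr 3 (by simp), hf₁.rarr 3 (by simp [copyLoop])]
  have hrow : ∀ q, row D s₄ q = row D s q := fun q => by simp only [row, setAt, e₃]
  refine (reach_accept hE₄ hk₄ hkn).imp le_rfl fun s' _ hs' => ?_
  simpa only [SameRow, hset₄, e₁, e₂, e₄, hrow] using hs'

theorem static_tryCand (M : ℕ) : (tryCand M).Static := by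
  constructor <;> simp [tryCand, copyLoop, countLoop, valueLoop, coveredLoop, accept]

theorem writesNReg_tryCand {M x : ℕ} (h : (tryCand M).WritesNReg x) : 6 ≤ x ∧ x ≤ 9 := by
  simp [tryCand, copyLoop, countLoop, valueLoop, coveredLoop, accept] at h
  omega

/-- Row `q` holds a selection of at most `q` vertices from `U` and its coverage. -/
structure RowValid (D : Scene) (a : ℕ) (U : ℕ → Prop) (s : Store) (q : ℕ) : Prop where
  mem : ∀ i ∈ row D s q, U i
  card : (row D s q).card ≤ q
  value : s.rarr 3 q = D.cov a (row D s q)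

/-- The value of row `q` is at least the coverage of every selection of at most `q` vertices
from `U`. -/
def RowOptimal (D : Scene) (a : ℕ) (U : ℕ → Prop) (s : Store) (q : ℕ) : Prop :=
  ∀ T ⊆ Finset.range D.n, (∀ i ∈ T, U i) → T.card ≤ q → D.cov a T ≤ s.rarr 3 q

theorem RowValid.congr {D : Scene} {a q : ℕ} {U V : ℕ → Prop} {s s' : Store}
    (h : RowValid D a U s q) (hs : SameRow D s s' q) (hUV : ∀ i, U i → V i) :
    RowValid D a V s' q :=
  ⟨by rw [hs.1]; exact fun i hi => hUV i (h.mem i hi), by rw [hs.1]; exact h.card,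
    by rw [hs.1, hs.2]; exact h.value⟩

/-- The classes of the vertices below `r` have been processed. -/
def Done (D : Scene) (a r i : ℕ) : Prop := ∃ r' < r, D.cls a r' = D.cls a i

theorem Done.mono {D : Scene} {a r r' i : ℕ} (h : Done D a r i) (hr : r ≤ r') : Done D a r' i := by
  obtain ⟨m, hm, he⟩ := h
  exact ⟨m, by omega, he⟩

theorem Done.of_cls_eq {D : Scene} {a r i : ℕ} (h : D.cls a i = D.cls a r) :
    Done D a (r + 1) i := ⟨r, by omega, h.symm⟩

theorem exists_marked_eq {D : Scene} {a r M : ℕ} {S : Finset ℕ} (hS : S ⊆ Finset.range D.n)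
    (hc : ∀ i ∈ S, D.cls a i = D.cls a r) (hM : S.card ≤ M) :
    ∃ τ : ℕ → ℕ, (∀ j, τ j ≤ D.n) ∧ marked D a r M τ = S := by
  -- The tuple lists `S` and is padded with `n`, which is not a vertex.
  refine ⟨fun j => S.toList.getD j D.n, fun j => ?_, ?_⟩
  · rcases lt_or_ge j S.toList.length with hj | hj
    · simp only [List.getD_eq_getElem _ _ hj]
      have := Finset.mem_toList.1 (List.getElem_mem hj)
      exact (Finset.mem_range.1 (hS this)).le
    · simp only [List.getD_eq_default _ _ hj, le_refl]
  · ext i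
    simp only [marked, Finset.mem_filter, Finset.mem_range]
    constructor
    · rintro ⟨hi, j, -, hji, -⟩
      rcases lt_or_ge j S.toList.length with hj | hj
      · rw [List.getD_eq_getElem _ _ hj] at hji
        exact hji ▸ Finset.mem_toList.1 (List.getElem_mem hj)
      · rw [List.getD_eq_default _ _ hj] at hji
        omega
    · intro hi
      obtain ⟨j, hj, hji⟩ := List.getElem_of_mem (Finset.mem_toList.2 hi)
      refine ⟨Finset.mem_range.1 (hS hi), j, ?_, ?_, hc i hi⟩
      · rw [Finset.length_toList] at hj; omega
      · rw [List.getD_eq_getElem _ _ hj, hji]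

theorem Scene.smallDominators (D : Scene) (a : ℕ) (b : ℕ × ℕ) :
    SmallDominators (Near D.x D.y D.d) (D.cls a) D.w D.n (D.K * D.K) b :=
  smallDominators_blockOf D.w_nonneg D.K_pos
    (fun _ hu _ hv => near_of_level_eq D.d_pos hu hv) b

/-- Trying all tuples turns the optimal row `k` for the classes below `r` into an optimal row for
the classes up to `r`, provided that the rows below `k` are still the old ones. -/
theorem reach_nest_tryCand {D : Scene} {s : Store} (h : Env D s) {M a r k : ℕ}
    (hM : M = D.K * D.K) (ha : s.nreg 2 = a) (haK : a < D.K) (hr : s.nreg 3 = r) (hrn : r < D.n)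
    (hk : s.nreg 5 = k) (hkn : k ≤ D.n)
    (hold : ∀ q ≤ k, RowValid D a (Done D a r) s q ∧ RowOptimal D a (Done D a r) s q)
    (hnew : ∀ q ≤ D.n, k < q → RowValid D a (Done D a (r + 1)) s q) :
    Reach D.n (nest (tryCand M) (M + 1)) s (8 * M + 47) fun s' =>
      (∀ q ≤ D.n, q ≠ k → SameRow D s s' q) ∧ RowValid D a (Done D a (r + 1)) s' k ∧
      RowOptimal D a (Done D a (r + 1)) s' k := by
  classical
  let cand : (ℕ → ℕ) → Finset ℕ := fun σ => row D s (σ 0) ∪ marked D a r M fun j => σ (1 + j)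
  have hvalid : ∀ q ≤ D.n, RowValid D a (Done D a (r + 1)) s q := fun q hq => by
    rcases le_or_gt q k with hqk | hqk
    · exact (hold q hqk).1.congr ⟨rfl, rfl⟩ fun i hi => hi.mono (by omega)
    · exact hnew q hq hqk
  refine (Reach.nest (k := M + 40)
    (fun s' => Env D s' ∧ s'.nreg 2 = a ∧ s'.nreg 3 = r ∧ s'.nreg 5 = k ∧
      (∀ q ≤ D.n, q ≠ k → SameRow D s s' q) ∧ RowValid D a (Done D a (r + 1)) s' k ∧
      s.rarr 3 k ≤ s'.rarr 3 k)
    -- Only rows below `k` are certain to be in their old state during the whole enumeration: those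
    -- above are already updated, and row `k` is changing.
    (fun σ s' => σ 0 < k → (cand σ).card ≤ k → D.cov a (cand σ) ≤ s'.rarr 3 k)
    (fun x hx => by have := writesNReg_tryCand hx; omega) (fun s' hs' => hs'.1.n)
    ?_ (fun _ _ _ _ _ h' => h') ?_ (by omega)
    ⟨h, ha, hr, hk, fun _ _ _ => ⟨rfl, rfl⟩, hvalid k hkn, le_rfl⟩).imp le_rfl ?_
  · rintro s' x v hx ⟨h₁, h₂, h₃, h₄, h₅, h₆, h₇⟩
    have e : ∀ y, y < 100 → (s'.setNReg x v).nreg y = s'.nreg y := fun y hy =>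
      Function.update_of_ne (by omega) _ _
    exact ⟨h₁.setNReg (by omega), by rw [e 2 (by omega), h₂], by rw [e 3 (by omega), h₃],
      by rw [e 5 (by omega), h₄], h₅, ⟨h₆.mem, h₆.card, h₆.value⟩, h₇⟩
  · rintro s' ⟨h₁, h₂, h₃, h₄, h₅, h₆, h₇⟩ hb
    refine (reach_tryCand h₁ h₂ haK h₃ hrn h₄ hkn rfl (hb 0 (by omega)) rfl).imp le_rfl ?_
    rintro s'' hf ⟨g₁, g₂⟩
    obtain ⟨C, hC⟩ : ∃ C, C = row D s' (s'.nreg 100) ∪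
      marked D a r M fun j => s'.nreg (101 + j) := ⟨_, rfl⟩
    rw [← hC] at g₂
    have hreg : ∀ x, x < 6 → s''.nreg x = s'.nreg x := fun x hx =>
      hf.nreg x fun hw => by have := writesNReg_tryCand hw; omega
    have hmono : s'.rarr 3 k ≤ s''.rarr 3 k := by
      split_ifs at g₂ with hc
      · rw [g₂.2]; exact hc.2
      · rw [g₂.2]
    refine ⟨⟨h₁.frame hf (static_tryCand M), (hreg 2 (by omega)).trans h₂,
      (hreg 3 (by omega)).trans h₃, (hreg 5 (by omega)).trans h₄, fun q hq hqk =>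
      ⟨(g₁ q hqk).1.trans (h₅ q hq hqk).1, (g₁ q hqk).2.trans (h₅ q hq hqk).2⟩, ?_,
      h₇.trans hmono⟩, fun σ hσ h0 hcard => (hσ h0 hcard).trans hmono, fun σ hσ h0 hcard => ?_⟩
    · split_ifs at g₂ with hc
      · refine ⟨?_, by rw [g₂.1]; exact hc.1, by rw [g₂.1, g₂.2]⟩
        rw [g₂.1, hC]
        intro i hi
        rcases Finset.mem_union.1 hi with hi | hi
        · by_cases hq : s'.nreg 100 = k
          · exact h₆.mem i (hq ▸ hi)
          · have hq' := hb 0 (by omega)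
            rw [add_zero] at hq'
            rw [(h₅ _ hq' hq).1] at hi
            exact (hvalid _ hq').mem i hi
        · obtain ⟨-, j, -, -, hj⟩ := Finset.mem_filter.1 hi
          exact Done.of_cls_eq hj
      · exact h₆.congr g₂ fun _ hi => hi
    · have hσ0 : s'.nreg 100 = σ 0 := (hσ 0 (by omega)).symm
      have hCσ : C = cand σ := by
        rw [hC, hσ0, (h₅ (σ 0) (by omega) (by omega)).1]
        have : ∀ i, (∃ j < M, s'.nreg (101 + j) = i ∧ D.cls a i = D.cls a r) ↔
            ∃ j < M, σ (1 + j) = i ∧ D.cls a i = D.cls a r := fun i => by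
          refine exists_congr fun j => and_congr_right fun hj => ?_
          rw [hσ (1 + j) (by omega), ← add_assoc]
        simp only [cand, marked, this]
      rw [← hCσ] at hcard ⊢
      split_ifs at g₂ with hc
      · exact g₂.2.ge
      · rw [g₂.2]
        exact (not_le.1 fun hle => hc ⟨hcard, hle⟩).le
  · rintro s' - ⟨⟨-, -, -, -, h₅, h₆, h₇⟩, -, hgood⟩
    refine ⟨h₅, h₆, fun T hT hTU hTk => ?_⟩
    -- If the class of `r` was processed before, the admissible vertices are the same as before, and
    -- row `k` has not become worse.
    by_cases hex : Done D a r r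
    · refine ((hold k le_rfl).2 T hT (fun i hi => ?_) hTk).trans h₇
      obtain ⟨m, hm, hmi⟩ := hTU i hi
      rcases Nat.lt_succ_iff_lt_or_eq.1 hm with hm | rfl
      · exact ⟨m, hm, hmi⟩
      · obtain ⟨m', hm', he⟩ := hex
        exact ⟨m', hm', he.trans hmi⟩
    obtain ⟨S, hSn, T₀, hT₀n, hSc, hSM, hSk, hT₀k, hT₀U, hext⟩ :=
      (D.smallDominators a (D.cls a r)).exists_extension (U := Done D a r)
        (fun i hi hc => hex (by obtain ⟨m, hm, he⟩ := hi; exact ⟨m, hm, he.trans hc⟩)) hT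
        (fun i hi => by
          obtain ⟨m, hm, hmi⟩ := hTU i hi
          rcases Nat.lt_succ_iff_lt_or_eq.1 hm with hm | rfl
          · exact Or.inl ⟨m, hm, hmi⟩
          · exact Or.inr hmi.symm) hTk
    have hrowk := hold (k - S.card) (by omega)
    have hcov := hext (row D s (k - S.card)) hrowk.1.mem
      ((hrowk.2 T₀ hT₀n hT₀U hT₀k).trans hrowk.1.value.le)
    refine hcov.trans ?_
    -- If nothing is taken from the new class, the old row `k` is already good enough. Otherwise the
    -- row extended is `k - S.card < k`, as `Good` requires.
    rcases Finset.eq_empty_or_nonempty S with rfl | hne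
    · rw [Finset.union_empty, Finset.card_empty, Nat.sub_zero]
      exact (hold k le_rfl).1.value.ge.trans h₇
    · have hpos := hne.card_pos
      obtain ⟨τ, hτn, hτ⟩ := exists_marked_eq hSn hSc (hM ▸ hSM)
      let σ : ℕ → ℕ := fun j => if j = 0 then k - S.card else τ (j - 1)
      have hσ : cand σ = row D s (k - S.card) ∪ S := by
        have e : (fun j => σ (1 + j)) = τ := by
          funext j
          simp [σ]
        simp only [cand, e, hτ]
        simp [σ]
      have := hgood σ (fun j _ => by
        by_cases hj : j = 0
        · simp only [σ, hj, if_true]; omega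
        · simp only [σ, hj, if_false]; exact hτn _)
        (by simp only [σ, if_true]; omega) (by
          rw [hσ]
          refine (Finset.card_union_le _ _).trans ?_
          have := hrowk.1.card
          omega)
      rwa [hσ] at this

end RealRAM

/-! ### The dynamic program over all classes, and the loop over all shifts -/

namespace RealRAM

/-- Process the class of the vertex in register 3: improve the rows `n, …, 0` in this order. -/
def dpStep (M : ℕ) : Prog :=
  forN 4 (.add (.reg 0) (.const 1))
    (.seq (.nset 5 (.sub (.reg 0) (.reg 4))) (nest (tryCand M) (M + 1)))

theorem writesNReg_dpStep {M x : ℕ} (h : (dpStep M).WritesNReg x) : 4 ≤ x := by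
  simp only [dpStep, writesNReg_forN, Prog.WritesNReg, writesNReg_nest] at h
  rcases h with h | h | h | h
  · omega
  · omega
  · have := writesNReg_tryCand h; omega
  · omega

theorem static_dpStep (M : ℕ) : (dpStep M).Static where
  nreg h := by have := writesNReg_dpStep h; omega
  rreg := by simpa [dpStep] using (static_tryCand M).rreg
  rarr₀ := by simpa [dpStep] using (static_tryCand M).rarr₀
  rarr₁ := by simpa [dpStep] using (static_tryCand M).rarr₁
  rarr₂ := by simpa [dpStep] using (static_tryCand M).rarr₂
  narr₁ := by simpa [dpStep] using (static_tryCand M).narr₁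
  narr₂ := by simpa [dpStep] using (static_tryCand M).narr₂
  narr₃ := by simpa [dpStep] using (static_tryCand M).narr₃
  narr₄ := by simpa [dpStep] using (static_tryCand M).narr₄
  narr₇ := by simpa [dpStep] using (static_tryCand M).narr₇

/-- As in the knapsack problem, the rows are updated in descending order. When row `k` is improved,
the smaller rows do not yet use the current class, so the class is not charged twice. -/
theorem reach_dpStep {D : Scene} {s : Store} (h : Env D s) {M a r : ℕ}
    (hM : M = D.K * D.K) (ha : s.nreg 2 = a) (haK : a < D.K) (hr : s.nreg 3 = r) (hrn : r < D.n)
    (hrow : ∀ q ≤ D.n, RowValid D a (Done D a r) s q ∧ RowOptimal D a (Done D a r) s q) :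
    Reach D.n (dpStep M) s (8 * M + 55) fun s' => ∀ q ≤ D.n,
      RowValid D a (Done D a (r + 1)) s' q ∧ RowOptimal D a (Done D a (r + 1)) s' q := by
  have hreg : ∀ {s'}, Frame (dpStep M) s s' → ∀ x, x < 4 → s'.nreg x = s.nreg x :=
    fun hf x hx => hf.nreg x fun hw => by have := writesNReg_dpStep hw; omega
  refine (Reach.forN (j := 1) (k := 8 * M + 48) (D.n + 1) (fun kk s' =>
    (∀ q ≤ D.n, q + kk ≤ D.n →
      RowValid D a (Done D a r) s' q ∧ RowOptimal D a (Done D a r) s' q) ∧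
    ∀ q ≤ D.n, D.n < q + kk →
      RowValid D a (Done D a (r + 1)) s' q ∧ RowOptimal D a (Done D a (r + 1)) s' q)
    (by simp) (by simp [NExpr.cost]) (by omega) ?_ ?_ ?_ ?_ ?_).imp le_rfl ?_
  · intro s' hf
    simp [NExpr.val, hreg hf 0 (by omega), h.n]
  · rintro i s' v ⟨h₁, h₂⟩
    exact ⟨fun q hq hq' => ⟨⟨(h₁ q hq hq').1.mem, (h₁ q hq hq').1.card, (h₁ q hq hq').1.value⟩,
      (h₁ q hq hq').2⟩, fun q hq hq' => ⟨⟨(h₂ q hq hq').1.mem, (h₂ q hq hq').1.card,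
      (h₂ q hq hq').1.value⟩, (h₂ q hq hq').2⟩⟩
  · simp only [Prog.WritesNReg, writesNReg_nest]
    rintro (h | h | h)
    · omega
    · have := writesNReg_tryCand h; omega
    · omega
  · exact ⟨fun q hq _ => hrow q hq, fun q hq hq' => by omega⟩
  · rintro kk hkk s' hf hx ⟨h₁, h₂⟩
    have hE : Env D s' := h.frame hf (static_dpStep M)
    refine Reach.seq (i := 2) (j := 8 * M + 47) (R := fun s₁ => s₁.nreg 5 = D.n - kk)
      (Reach.nset (by simp [NExpr.cost]) (by simp [Store.setNReg, NExpr.val, hE.n, hx]))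
      (fun s₁ hf₁ hk => ?_) (by omega) (by omega)
    have h5 : s₁.narr 5 = s'.narr 5 := hf₁.narr 5 (by simp)
    have h3 : s₁.rarr 3 = s'.rarr 3 := hf₁.rarr 3 (by simp)
    have hsame : ∀ q, SameRow D s' s₁ q := fun q => ⟨by simp only [row, setAt, h5], by rw [h3]⟩
    refine (reach_nest_tryCand (hE.frame hf₁ (by constructor <;> simp)) hM
      ((hf₁.nreg 2 (by simp)).trans ((hreg hf 2 (by omega)).trans ha)) haK
      ((hf₁.nreg 3 (by simp)).trans ((hreg hf 3 (by omega)).trans hr)) hrn hk (by omega)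
      (fun q hq => ?_) (fun q hq hq' => ?_)).imp le_rfl fun s₂ _ hs₂ => ?_
    · have := h₁ q (by omega) (by omega)
      refine ⟨this.1.congr (hsame q) fun _ hi => hi, ?_⟩
      simpa only [RowOptimal, h3] using this.2
    · exact (h₂ q hq (by omega)).1.congr (hsame q) fun _ hi => hi
    · obtain ⟨g₁, g₂, g₃⟩ := hs₂
      have hs : ∀ q ≤ D.n, q ≠ D.n - kk → SameRow D s' s₂ q := fun q hq hq' =>
        ⟨(g₁ q hq hq').1.trans (hsame q).1, (g₁ q hq hq').2.trans (hsame q).2⟩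
      refine ⟨fun q hq hq' => ?_, fun q hq hq' => ?_⟩
      · have := h₁ q hq (by omega)
        have e := hs q hq (by omega)
        exact ⟨this.1.congr e fun _ hi => hi, by simpa only [RowOptimal, e.2] using this.2⟩
      · by_cases hqk : q = D.n - kk
        · rw [hqk]; exact ⟨g₂, g₃⟩
        · have := h₂ q hq (by omega)
          have e := hs q hq hqk
          exact ⟨this.1.congr e fun _ hi => hi, by simpa only [RowOptimal, e.2] using this.2⟩
  · exact fun s' _ hs' q hq => hs'.2 q hq (by omega)

/-- Make all rows of the table empty. -/
def resetLoop : Prog :=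
  forN 4 (.add (.reg 0) (.const 1))
    (.seq (.rput 3 (.reg 4) (.const 0)) (copyLoop 5 7 (.get 4 (.reg 4)) (.const 0)))

theorem static_resetLoop : resetLoop.Static := by constructor <;> simp [resetLoop, copyLoop]

theorem reach_resetLoop {D : Scene} {s : Store} (h : Env D s) :
    Reach D.n resetLoop s 20 fun s' => ∀ q ≤ D.n, row D s' q = ∅ ∧ s'.rarr 3 q = 0 := by
  refine (Reach.forN (j := 1) (k := 12) (k' := 19) (D.n + 1) (fun k s' => ∀ q < k,
    (∀ i < D.n, s'.narr 5 (q * D.n + i) = 0) ∧ s'.rarr 3 q = 0) (by simp)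
    (by simp [NExpr.cost]) (by omega) ?_ (fun _ _ _ h => h) (by simp [copyLoop])
    (fun q hq => absurd hq (Nat.not_lt_zero _)) ?_).imp (by omega) ?_
  · intro s' hf
    simpa [NExpr.val, h.n] using hf.nreg 0 static_resetLoop.nreg
  · intro k hk s' hf hx hI
    have hE : Env D s' := h.frame hf static_resetLoop
    refine Reach.seq (i := 2) (j := 11) (R := fun s₁ => s₁.rarr 3 =
      Function.update (s'.rarr 3) k 0) (Reach.rput (by simp [NExpr.cost, RExpr.cost])
      (by simp [Store.setRArr, NExpr.val, RExpr.val, hx])) (fun s₁ hf₁ h₁ => ?_)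
      (by omega) (by omega)
    have hE₁ : Env D s₁ := hE.frame hf₁ (by constructor <;> simp)
    have hk₁ : s₁.nreg 4 = k := (hf₁.nreg 4 (by simp)).trans hx
    have h5 : s₁.narr 5 = s'.narr 5 := hf₁.narr 5 (by simp)
    refine (reach_copyLoop (p := k * D.n) (q := 0) (by omega) hE₁.n (fun s₂ hf₂ => ?_)
      (fun _ _ => rfl) (by simp [NExpr.cost]) le_rfl).imp le_rfl fun s₂ hf₂ hs₂ q hq => ?_
    · have e₁ : s₂.nreg 4 = k := (hf₂.nreg 4 (by simp [copyLoop])).trans hk₁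
      have e₂ : s₂.narr 4 = s₁.narr 4 := hf₂.narr 4 (by simp [copyLoop])
      simp [NExpr.val, e₁, e₂, hE₁.mul k (by omega)]
    · rw [hf₂.rarr 3 (by simp [copyLoop]), h₁]
      rcases Nat.lt_succ_iff_lt_or_eq.1 hq with hq | rfl
      · refine ⟨fun i hi => ?_, ?_⟩
        · rw [hs₂, hE₁.zero, h5, (hI q hq).1 i hi, ite_self]
        · rw [Function.update_of_ne (by omega), (hI q hq).2]
      · refine ⟨fun i hi => ?_, Function.update_self _ _ _⟩
        rw [hs₂, if_pos (by omega), hE₁.zero]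
  · intro s' _ hs' q hq
    refine ⟨Finset.filter_eq_empty_iff.2 fun i hi => ?_, (hs' q (by omega)).2⟩
    simpa using (hs' q (by omega)).1 i (Finset.mem_range.1 hi)

/-- The dynamic program for the shift in register 2. -/
def dpAll (M : ℕ) : Prog := .seq resetLoop (forN 3 (.reg 0) (dpStep M))

theorem writesNReg_dpAll {M x : ℕ} (h : (dpAll M).WritesNReg x) : 3 ≤ x := by
  simp only [dpAll, resetLoop, copyLoop, writesNReg_forN, Prog.WritesNReg] at h
  rcases h with (h | h | h | h) | h | h
  any_goals omega
  all_goals first | exact h.elim | (have := writesNReg_dpStep h; omega)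

theorem static_dpAll (M : ℕ) : (dpAll M).Static where
  nreg h := by have := writesNReg_dpAll h; omega
  rreg := by simpa [dpAll, static_resetLoop.rreg] using (static_dpStep M).rreg
  rarr₀ := by simpa [dpAll, static_resetLoop.rarr₀] using (static_dpStep M).rarr₀
  rarr₁ := by simpa [dpAll, static_resetLoop.rarr₁] using (static_dpStep M).rarr₁
  rarr₂ := by simpa [dpAll, static_resetLoop.rarr₂] using (static_dpStep M).rarr₂
  narr₁ := by simpa [dpAll, static_resetLoop.narr₁] using (static_dpStep M).narr₁
  narr₂ := by simpa [dpAll, static_resetLoop.narr₂] using (static_dpStep M).narr₂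
  narr₃ := by simpa [dpAll, static_resetLoop.narr₃] using (static_dpStep M).narr₃
  narr₄ := by simpa [dpAll, static_resetLoop.narr₄] using (static_dpStep M).narr₄
  narr₇ := by simpa [dpAll, static_resetLoop.narr₇] using (static_dpStep M).narr₇

/-- Every vertex represents its own class, so after all `n` vertices each vertex is admissible and
the restriction in `RowOptimal` disappears. -/
theorem reach_dpAll {D : Scene} {s : Store} (h : Env D s) {M a : ℕ}
    (hM : M = D.K * D.K) (ha : s.nreg 2 = a) (haK : a < D.K) :
    Reach D.n (dpAll M) s (8 * M + 63) fun s' => ∀ q ≤ D.n, (row D s' q).card ≤ q ∧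
      s'.rarr 3 q = D.cov a (row D s' q) ∧
      ∀ T ⊆ Finset.range D.n, T.card ≤ q → D.cov a T ≤ s'.rarr 3 q := by
  refine Reach.seq (reach_resetLoop h) (fun s₁ hf₁ h₁ => ?_) (by omega)
    (show 8 * M + 62 < 8 * M + 63 by omega)
  have hE₁ := h.frame hf₁ static_resetLoop
  have ha₁ : s₁.nreg 2 = a := (hf₁.nreg 2 (by simp [resetLoop, copyLoop])).trans ha
  have hstat : (forN 3 (.reg 0) (dpStep M)).Static := by
    obtain ⟨g₁, g₂, g₃, g₄, g₅, g₆, g₇, g₈, g₉, g₁₀⟩ := static_dpStep M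
    constructor <;> simpa
  refine (Reach.forN (j := 1) (k := 8 * M + 55) D.n (fun r s' => ∀ q ≤ D.n,
    RowValid D a (Done D a r) s' q ∧ RowOptimal D a (Done D a r) s' q)
    (by simp) (by simp [NExpr.cost]) (by omega) ?_ ?_ ?_ ?_ ?_).imp le_rfl ?_
  · intro s' hf
    simpa [NExpr.val, hE₁.n] using hf.nreg 0 hstat.nreg
  · exact fun r s' v hI q hq => ⟨⟨(hI q hq).1.mem, (hI q hq).1.card, (hI q hq).1.value⟩,
      (hI q hq).2⟩
  · intro hw
    have := writesNReg_dpStep hw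
    omega
  · have hcov : D.cov a ∅ = 0 := by
      classical
      unfold Scene.cov coverage
      refine Finset.sum_eq_zero fun v _ => if_neg ?_
      rintro ⟨u, hu, -⟩
      exact absurd hu (Finset.notMem_empty u)
    refine fun q hq => ⟨⟨?_, ?_, ?_⟩, fun T _ hT _ => ?_⟩
    · simp [(h₁ q hq).1]
    · simp [(h₁ q hq).1]
    · rw [(h₁ q hq).1, (h₁ q hq).2, hcov]
    · have : T = ∅ := Finset.eq_empty_of_forall_notMem fun i hi => by
        obtain ⟨m, hm, -⟩ := hT i hi
        omega
      rw [this, hcov, (h₁ q hq).2]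
  · intro r hr s' hf hx hI
    exact reach_dpStep (hE₁.frame hf hstat) hM
      ((hf.nreg 2 fun hw => by
        rcases writesNReg_forN.1 hw with hw | hw
        · omega
        · have := writesNReg_dpStep hw; omega).trans ha₁) haK hx hr hI
  · exact fun s' _ hs' q hq => ⟨(hs' q hq).1.card, (hs' q hq).1.value, fun T hT hc =>
      (hs' q hq).2 T hT (fun i hi => ⟨i, Finset.mem_range.1 (hT hi), rfl⟩) hc⟩

/-- Output the row of the budget if it is not worse than the best selection so far. -/
def collect : Prog :=
  .cond (.rle (.reg 2) (.get 3 (.reg 1)))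
    (.seq (.rset 2 (.get 3 (.reg 1))) (copyLoop 0 5 (.const 0) (.get 4 (.reg 1)))) .nop

theorem reach_collect {D : Scene} {s : Store} (h : Env D s) {L : ℕ} (hL : s.nreg 1 = L)
    (hLn : L ≤ D.n) :
    Reach D.n collect s 13 fun s' =>
      if s.rreg 2 ≤ s.rarr 3 L then s'.rreg 2 = s.rarr 3 L ∧ setAt D.n s' 0 0 = row D s L
      else s' = s := by
  have hb : (BExpr.rle (.reg 2) (.get 3 (.reg 1))).holds s ↔ s.rreg 2 ≤ s.rarr 3 L := by
    simp only [BExpr.holds, NExpr.val, RExpr.val, hL]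
  refine Reach.cond (i := 3) (j := 12) (by simp [BExpr.cost, NExpr.cost, RExpr.cost])
    (fun hb' => ?_) (fun hb' => Reach.nop ?_) (by omega) (by omega)
  · simp only [if_pos (hb.1 hb')]
    refine Reach.seq (i := 2) (R := fun s' => s'.rreg 2 = s.rarr 3 L)
      (Reach.rset (by simp [NExpr.cost, RExpr.cost])
      (by simp [Store.setRReg, NExpr.val, RExpr.val, hL]))
      (fun s₁ hf₁ h₁ => ?_) (by omega) (lt_add_one 11)
    have hE₁ : Env D s₁ := h.frame hf₁ (by constructor <;> simp)
    have hL₁ : s₁.nreg 1 = L := (hf₁.nreg 1 (by simp)).trans hL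
    have h5 : s₁.narr 5 = s.narr 5 := hf₁.narr 5 (by simp)
    refine (reach_copyLoop (p := 0) (q := L * D.n) (by omega) hE₁.n (fun _ _ => rfl)
      (fun s' hf => ?_) (by simp [NExpr.cost]) le_rfl).imp le_rfl fun s' hf hs' => ⟨?_, ?_⟩
    · have e₁ : s'.nreg 1 = L := (hf.nreg 1 (by simp [copyLoop])).trans hL₁
      have e₂ : s'.narr 4 = s₁.narr 4 := hf.narr 4 (by simp [copyLoop])
      simp [NExpr.val, e₁, e₂, hE₁.mul L hLn]
    · rw [hf.rreg 2 (by simp [copyLoop]), h₁]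
    · refine Finset.filter_congr fun i hi => ?_
      have hi := Finset.mem_range.1 hi
      rw [hs', if_pos (by omega), h5, zero_add, Nat.sub_zero]
  · rw [if_neg (hb.not.1 hb')]

/-- Run the dynamic program for all shifts and collect the best result. -/
def shiftLoop (K M : ℕ) : Prog := forN 2 (.const K) (.seq (dpAll M) collect)

theorem static_shiftLoop (K M : ℕ) : (shiftLoop K M).Static := by
  obtain ⟨g₁, g₂, g₃, g₄, g₅, g₆, g₇, g₈, g₉, g₁₀⟩ := static_dpAll M
  constructor <;> simpa [shiftLoop, collect, copyLoop]

/-- The coverage irrespective of classes. -/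
noncomputable def Scene.fullCov (D : Scene) (S : Finset ℕ) : ℝ :=
  coverage (Near D.x D.y D.d) (fun _ => ()) D.w D.n S

/-- The program maximizes coverage within blocks; this bound guarantees that the true payoff of its
output is not smaller. -/
theorem Scene.cov_le_fullCov (D : Scene) (a : ℕ) (S : Finset ℕ) : D.cov a S ≤ D.fullCov S := by
  classical
  unfold Scene.cov Scene.fullCov coverage
  refine Finset.sum_le_sum fun v _ => ?_
  split_ifs with h₁ h₂
  · rfl
  · obtain ⟨u, hu, hn, -⟩ := h₁
    exact absurd ⟨u, hu, hn, rfl⟩ h₂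
  · exact D.w_nonneg v
  · rfl

theorem Scene.exists_shift (D : Scene) (T : Finset ℕ) :
    ∃ a < D.K, (1 - 4 / (D.K : ℝ)) * D.fullCov T ≤ D.cov a T := by
  refine exists_shift_coverage D.w_nonneg D.K_pos (fun u v h => ?_) (fun u v h => ?_) T
  · have := abs_le.1 (h.abs_sub_le D.d_pos).1
    exact ⟨level_le_add_two D.d_pos (by linarith), level_le_add_two D.d_pos (by linarith)⟩
  · have := abs_le.1 (h.abs_sub_le D.d_pos).2
    exact ⟨level_le_add_two D.d_pos (by linarith), level_le_add_two D.d_pos (by linarith)⟩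

/-- The best value is compared with the optimum of every shift. So the shift that suits `T` may
depend on `T` and need not be known to the program. -/
theorem reach_shiftLoop {D : Scene} {s : Store} (h : Env D s) {M L : ℕ} (hM : M = D.K * D.K)
    (hL : s.nreg 1 = L) (hLn : L ≤ D.n) (hout : setAt D.n s 0 0 = ∅) (hbest : s.rreg 2 = 0) :
    Reach D.n (shiftLoop D.K M) s (D.K + 8 * M + 70) fun s' =>
      (setAt D.n s' 0 0).card ≤ L ∧ ∀ T ⊆ Finset.range D.n, T.card ≤ L →
        (1 - 4 / (D.K : ℝ)) * D.fullCov T ≤ D.fullCov (setAt D.n s' 0 0) := by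
  refine (Reach.forN (j := D.K) (k := 8 * M + 64) D.K (fun a s' =>
    (setAt D.n s' 0 0).card ≤ L ∧ s'.rreg 2 ≤ D.fullCov (setAt D.n s' 0 0) ∧
      ∀ a' < a, ∀ T ⊆ Finset.range D.n, T.card ≤ L → D.cov a' T ≤ s'.rreg 2)
    -- The number of iterations `K` is bounded by `2 ^ K`, hence by `(n + 2) ^ K`; this contributes
    -- the summand `D.K` of the exponent.
    ((Nat.lt_two_pow_self).le.trans (two_pow_le _ _)) (by simp [NExpr.cost]) (by omega)
    (fun _ _ => rfl) (fun _ _ _ h => h) ?_ ?_ ?_).imp le_rfl ?_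
  · intro hw
    rcases hw with hw | hw
    · have := writesNReg_dpAll hw; omega
    · simp [collect, copyLoop] at hw
  · refine ⟨by simp [hout], ?_, fun a' ha' => absurd ha' (Nat.not_lt_zero _)⟩
    rw [hbest]
    exact coverage_nonneg D.w_nonneg _
  · rintro a ha s' hf hx ⟨h₁, h₂, h₃⟩
    have hE : Env D s' := h.frame hf (static_shiftLoop _ M)
    have hL' : s'.nreg 1 = L := (hf.nreg 1 fun hw => by
      rcases writesNReg_forN.1 hw with hw | hw | hw
      · omega
      · have := writesNReg_dpAll hw; omega
      · simp [collect, copyLoop] at hw).trans hL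
    refine Reach.seq (j := 13) (reach_dpAll hE hM hx ha) (fun s₁ hf₁ hs₁ => ?_)
      (by omega) (by omega)
    have hE₁ := hE.frame hf₁ (static_dpAll M)
    have hL₁ : s₁.nreg 1 = L := (hf₁.nreg 1 fun hw => by
      have := writesNReg_dpAll hw; omega).trans hL'
    obtain ⟨g₁, g₂, g₃⟩ := hs₁ L hLn
    have hr : s₁.rreg 2 = s'.rreg 2 := hf₁.rreg 2 (by
      simp [dpAll, resetLoop, copyLoop, dpStep, tryCand, countLoop, valueLoop, coveredLoop, accept])
    have ho : s₁.narr 0 = s'.narr 0 := hf₁.narr 0 (by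
      simp [dpAll, resetLoop, copyLoop, dpStep, tryCand, countLoop, valueLoop, coveredLoop, accept])
    refine (reach_collect hE₁ hL₁ hLn).imp le_rfl fun s₂ _ hs₂ => ?_
    split_ifs at hs₂ with hc
    · rw [hs₂.1, hs₂.2]
      refine ⟨g₁, g₂.le.trans (D.cov_le_fullCov a _), fun a' ha' T hT hTL => ?_⟩
      rcases Nat.lt_succ_iff_lt_or_eq.1 ha' with ha' | rfl
      · exact (h₃ a' ha' T hT hTL).trans (hr ▸ hc)
      · exact g₃ T hT hTL
    · have hset : setAt D.n s₁ 0 0 = setAt D.n s' 0 0 := by simp only [setAt, ho]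
      rw [hs₂, hset, hr]
      refine ⟨h₁, h₂, fun a' ha' T hT hTL => ?_⟩
      rcases Nat.lt_succ_iff_lt_or_eq.1 ha' with ha' | rfl
      · exact h₃ a' ha' T hT hTL
      · exact (g₃ T hT hTL).trans (hr ▸ (not_le.1 hc).le)
  · rintro s' - ⟨h₁, h₂, h₃⟩
    refine ⟨h₁, fun T hT hTL => ?_⟩
    obtain ⟨a, ha, hcov⟩ := D.exists_shift T
    exact hcov.trans ((h₃ a ha T hT hTL).trans h₂)

end RealRAM

/-! ### Preparation of the tables and computation of the levels -/

namespace RealRAM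

/-- Tabulate the multiples of `n`. -/
def mulTable : Prog :=
  forN 6 (.reg 0) (.nput 4 (.add (.reg 6) (.const 1)) (.add (.get 4 (.reg 6)) (.reg 0)))

theorem reach_mulTable {n : ℕ} {s : Store} (hn : s.nreg 0 = n) (h0 : s.narr 4 0 = 0) :
    Reach n mulTable s 11 fun s' => ∀ k ≤ n, s'.narr 4 k = k * n := by
  refine Reach.forN (j := 1) (k := 4) n (fun i s' => ∀ k ≤ i, s'.narr 4 k = k * n) (by simp)
    (by simp [NExpr.cost]) (by omega) (fun s' hf => ?_) (fun _ _ _ h => h) (by simp) ?_ ?_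
  · simpa [NExpr.val, hn] using hf.nreg 0 (by simp)
  · intro k hk
    rw [Nat.le_zero.1 hk, h0, zero_mul]
  · intro i hi s' hf hx hI
    refine Reach.nput (by simp [NExpr.cost]) fun k hk => ?_
    have hn' : s'.nreg 0 = n := (hf.nreg 0 (by simp)).trans hn
    simp only [Store.setNArr, NExpr.val, hx, hn', Function.update_self, Function.update_apply]
    split_ifs with hki
    · rw [hki, hI i le_rfl, add_mul, one_mul]
    · exact hI k (by omega)

/-- Tabulate the quotients by `K`. -/
def divTable (K : ℕ) : Prog :=
  forN 6 (.reg 0) (.nput 3 (.add (.reg 6) (.const K)) (.add (.get 3 (.reg 6)) (.const 1)))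

/-- Division is replaced by the recursion `(j + K) / K = j / K + 1`. The first `K` entries are
correct because the memory is initially zero. -/
theorem reach_divTable {n K : ℕ} (hK : 0 < K) {s : Store} (hn : s.nreg 0 = n)
    (h0 : ∀ j, s.narr 3 j = 0) :
    Reach n (divTable K) s 11 fun s' => ∀ j < n + K, s'.narr 3 j = j / K := by
  refine Reach.forN (j := 1) (k := 4) n (fun i s' => ∀ j < i + K, s'.narr 3 j = j / K) (by simp)
    (by simp [NExpr.cost]) (by omega) (fun s' hf => ?_) (fun _ _ _ h => h) (by simp) ?_ ?_
  · simpa [NExpr.val, hn] using hf.nreg 0 (by simp)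
  · intro j hj
    rw [h0, Nat.div_eq_of_lt (by omega)]
  · intro i hi s' hf hx hI
    refine Reach.nput (by simp [NExpr.cost]) fun j hj => ?_
    simp only [Store.setNArr, NExpr.val, hx, Function.update_self, Function.update_apply]
    split_ifs with hji
    · rw [hji, hI i (by omega), Nat.add_div_right _ hK]
    · exact hI j (by omega)

/-- Raise the level of the vertex in register 6 if there is a gap between it and the one in
register 7. -/
def raise (a b : ℕ) : Prog :=
  .cond (.and (.not (.rle (.add (.sub (.get a (.reg 6)) (.get a (.reg 7)))
      (.sub (.get a (.reg 6)) (.get a (.reg 7)))) (.reg 0)))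
      (.nle (.get b (.reg 6)) (.get b (.reg 7))))
    (.nput b (.reg 6) (.add (.get b (.reg 7)) (.const 1))) .nop

/-- Compute the levels of the coordinates in the real array `a`. -/
def levelLoop (a b : ℕ) : Prog :=
  forN 2 (.reg 0) (forN 6 (.reg 0) (forN 7 (.reg 0) (raise a b)))

section

variable {n a b : ℕ} {x : ℕ → ℝ} {d : ℝ} {s : Store}

/-- The entries of the array `b` are between the levels truncated at `r` and the levels. -/
def LevelBounds (n b : ℕ) (x : ℕ → ℝ) (d : ℝ) (r : ℕ) (s : Store) : Prop :=
  ∀ m < n, s.narr b m ≤ level x d n m ∧ min (level x d n m) r ≤ s.narr b m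

/-- A gap from `j` to `i` makes the level of `j` plus one a lower bound for the level of `i`, so
raising never overshoots. -/
theorem reach_raise {r i j : ℕ} (hd : s.rreg 0 = d) (hd0 : 0 < d) (hx : s.rarr a = x)
    (h6 : s.nreg 6 = i) (hi : i < n) (h7 : s.nreg 7 = j) (hj : j < n)
    (hb : LevelBounds n b x d r s) :
    Reach n (raise a b) s 6 fun s' => LevelBounds n b x d r s' ∧
      (∀ m, s.narr b m ≤ s'.narr b m) ∧
      (Gap x d j i → min (level x d n j) r + 1 ≤ s'.narr b i) := by
  refine Reach.cond (i := 5) (j := 3) (by simp [BExpr.cost, NExpr.cost, RExpr.cost])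
    (fun hc => Reach.nput (by simp [NExpr.cost]) ?_) (fun hc => Reach.nop ?_) (by omega) (by omega)
  · simp only [BExpr.holds, RExpr.val, NExpr.val, h6, h7, hx, hd, not_le] at hc
    have hg : Gap x d j i := hc.1
    have hlt := level_lt_of_gap hd0 hj hg
    simp only [LevelBounds, Store.setNArr, NExpr.val, h6, h7, Function.update_self,
      Function.update_apply]
    refine ⟨fun m hm => ?_, fun m => ?_, fun _ => ?_⟩
    · split_ifs with hmi
      · subst hmi
        have h₁ := hb j hj
        have h₂ := hb m hm
        omega
      · exact hb m hm
    · split_ifs with hmi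
      · subst hmi; omega
      · rfl
    · have := hb j hj; omega
  · simp only [BExpr.holds, RExpr.val, NExpr.val, h6, h7, hx, hd, not_le, not_and] at hc
    refine ⟨hb, fun m => le_rfl, fun hg => ?_⟩
    have h₁ := hc hg
    have h₂ := hb j hj
    omega

/-- Longest chains are computed by relaxation in the manner of Bellman and Ford: `r` rounds make all
levels up to `r` correct, and `n` rounds suffice because every level is below `n`. -/
theorem reach_levelLoop (hn : s.nreg 0 = n) (hd : s.rreg 0 = d) (hd0 : 0 < d)
    (hx : s.rarr a = x) (h0 : ∀ i, s.narr b i = 0) :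
    Reach n (levelLoop a b) s 27 fun s' => ∀ i < n, s'.narr b i = level x d n i := by
  have wN : ∀ {s' s''}, Frame (levelLoop a b) s' s'' → s''.nreg 0 = s'.nreg 0 :=
    fun hf => hf.nreg 0 (by simp [levelLoop, raise])
  refine (Reach.forN (j := 1) (k := 20) n (LevelBounds n b x d) (by simp) (by simp [NExpr.cost])
    (by omega) (fun s' hf => (wN hf).trans hn) (fun _ _ _ h => h) (by simp [raise]) ?_ ?_).imp
    le_rfl ?_
  · exact fun m hm => ⟨by simp [h0], by simp⟩
  · intro r hr s₁ hf₁ _ hI₁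
    have hn₁ : s₁.nreg 0 = n := (wN hf₁).trans hn
    have hd₁ : s₁.rreg 0 = d := (hf₁.rreg 0 (by simp [raise])).trans hd
    have hx₁ : s₁.rarr a = x := (hf₁.rarr a (by simp [raise])).trans hx
    refine (Reach.forN (j := 1) (k := 13) n (fun i s' => LevelBounds n b x d r s' ∧
      ∀ m < i, min (level x d n m) (r + 1) ≤ s'.narr b m) (by simp) (by simp [NExpr.cost])
      (by omega) (fun s' hf => by exact (hf.nreg 0 (by simp [raise])).trans hn₁) (fun _ _ _ h => h)
      (by simp [raise]) ⟨hI₁, fun m hm => absurd hm (Nat.not_lt_zero _)⟩ ?_).imp le_rfl ?_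
    · rintro i hi s₂ hf₂ h6 ⟨hb₂, hI₂⟩
      have hn₂ : s₂.nreg 0 = n := (hf₂.nreg 0 (by simp [raise])).trans hn₁
      have hd₂ : s₂.rreg 0 = d := (hf₂.rreg 0 (by simp [raise])).trans hd₁
      have hx₂ : s₂.rarr a = x := (hf₂.rarr a (by simp [raise])).trans hx₁
      refine (Reach.forN (j := 1) (k := 6) n (fun j s' => LevelBounds n b x d r s' ∧
        (∀ m < i, min (level x d n m) (r + 1) ≤ s'.narr b m) ∧
        ∀ m < j, Gap x d m i → min (level x d n m) r + 1 ≤ s'.narr b i) (by simp)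
        (by simp [NExpr.cost]) (by omega)
        (fun s' hf => by exact (hf.nreg 0 (by simp [raise])).trans hn₂) (fun _ _ _ h => h) (by simp [raise])
        ⟨hb₂, hI₂, fun m hm => absurd hm (Nat.not_lt_zero _)⟩ ?_).imp le_rfl ?_
      · rintro j hj s₃ hf₃ h7 ⟨hb₃, hI₃, hJ₃⟩
        refine (reach_raise ((hf₃.rreg 0 (by simp [raise])).trans hd₂) hd0
          ((hf₃.rarr a (by simp [raise])).trans hx₂)
          ((hf₃.nreg 6 (by simp [raise])).trans h6) hi h7 hj hb₃).imp le_rfl ?_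
        rintro s₄ - ⟨g₁, g₂, g₃⟩
        refine ⟨g₁, fun m hm => (hI₃ m hm).trans (g₂ m), fun m hm hg => ?_⟩
        rcases Nat.lt_succ_iff_lt_or_eq.1 hm with hm | rfl
        · exact (hJ₃ m hm hg).trans (g₂ i)
        · exact g₃ hg
      · rintro s₃ - ⟨hb₃, hI₃, hJ₃⟩
        refine ⟨hb₃, fun m hm => ?_⟩
        rcases Nat.lt_succ_iff_lt_or_eq.1 hm with hm | rfl
        · exact hI₃ m hm
        · rcases Nat.eq_zero_or_pos (level x d n m) with h | h
          · omega
          -- The last gap of a longest chain ending in `m` starts at some `j` of level one less,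
          -- whose entry was correct up to `r` before this round.
          · obtain ⟨j, hj, hg, he⟩ := exists_gap_of_level_pos h
            have := hJ₃ j hj hg
            omega
    · rintro s₂ - ⟨hb₂, hI₂⟩ m hm
      exact ⟨(hb₂ m hm).1, hI₂ m hm⟩
  · intro s' _ hs' i hi
    have h₁ := hs' i hi
    have h₂ := level_lt (x := x) hd0 hi
    omega

end

/-- Replace the budget by `n` if it is larger. -/
def clamp : Prog := .cond (.nle (.reg 0) (.reg 1)) (.nset 1 (.reg 0)) .nop

/-- The table has rows `0, …, n` only, and a budget above `n` is no better than `n`. -/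
theorem reach_clamp {n : ℕ} {s : Store} :
    Reach n clamp s 4 fun s' => s'.nreg 1 = min (s.nreg 1) (s.nreg 0) := by
  refine Reach.cond (i := 2) (j := 1) (by simp [BExpr.cost, NExpr.cost])
    (fun hc => Reach.nset (by simp [NExpr.cost]) ?_) (fun hc => Reach.nop ?_) (by omega) (by omega)
  all_goals simp only [BExpr.holds, NExpr.val] at hc
  · simp [Store.setNReg, NExpr.val, hc]
  · omega

/-- The preparation of the tables. -/
def setup (K : ℕ) : Prog :=
  .seq clamp (.seq mulTable (.seq (divTable K) (.seq (levelLoop 0 1) (levelLoop 1 2))))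

/-- The whole algorithm for grids of size `K`. -/
def domination (K : ℕ) : Prog := .seq (setup K) (shiftLoop K (K * K))

end RealRAM

/-! ### Translation between instances and the memory of the machine -/

namespace UnitDiskInstance

open RealRAM

theorem toArray_nonneg {n : ℕ} {f : Fin n → ℝ} (hf : ∀ i, 0 ≤ f i) (i : ℕ) : 0 ≤ toArray f i := by
  unfold toArray
  split_ifs
  exacts [hf _, le_rfl]

theorem toArray_val {n : ℕ} (f : Fin n → ℝ) (i : Fin n) : toArray f i = f i := by
  simp [toArray]

/-- The data of an instance together with a grid size. -/
noncomputable def scene (I : UnitDiskInstance) (K : ℕ) (hK : 0 < K) : Scene where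
  n := I.n
  K := K
  d := I.diam
  x := toArray fun i => I.point i 0
  y := toArray fun i => I.point i 1
  w := toArray I.weight
  K_pos := hK
  d_pos := I.diam_pos
  w_nonneg := toArray_nonneg I.weight_nonneg

theorem reach_setup (I : UnitDiskInstance) (K : ℕ) (hK : 0 < K) :
    Reach I.n (setup K) I.input 31 fun s => Env (I.scene K hK) s ∧
      s.nreg 1 = min I.budget I.n ∧ s.narr 0 = (fun _ => 0) ∧ s.rreg 2 = 0 := by
  refine Reach.seq (j := 30) reach_clamp (fun s₁ f₁ h₁ => ?_) (by omega) (by omega)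
  have n₁ : s₁.nreg 0 = I.n := f₁.nreg 0 (by simp [clamp])
  have a₁ : ∀ a, s₁.narr a = fun _ => 0 := fun a => f₁.narr a (by simp [clamp])
  refine Reach.seq (j := 29) (reach_mulTable n₁ (by simp [a₁])) (fun s₂ f₂ h₂ => ?_)
    (by omega) (by omega)
  have n₂ : s₂.nreg 0 = I.n := (f₂.nreg 0 (by simp [mulTable])).trans n₁
  have a₂ : ∀ a, a ≠ 4 → s₂.narr a = fun _ => 0 := fun a ha =>
    (f₂.narr a (by simp [mulTable, ha])).trans (a₁ a)
  refine Reach.seq (j := 28) (reach_divTable hK n₂ (by simp [a₂])) (fun s₃ f₃ h₃ => ?_)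
    (by omega) (by omega)
  have n₃ : s₃.nreg 0 = I.n := (f₃.nreg 0 (by simp [divTable])).trans n₂
  have a₃ : ∀ a, a ≠ 4 → a ≠ 3 → s₃.narr a = fun _ => 0 := fun a ha ha' =>
    (f₃.narr a (by simp [divTable, ha'])).trans (a₂ a ha)
  have r₃ : ∀ x, s₃.rreg x = I.input.rreg x := fun x => by
    rw [f₃.rreg x (by simp [divTable]), f₂.rreg x (by simp [mulTable]),
      f₁.rreg x (by simp [clamp])]
  have b₃ : ∀ x, s₃.rarr x = I.input.rarr x := fun x => by
    rw [f₃.rarr x (by simp [divTable]), f₂.rarr x (by simp [mulTable]),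
      f₁.rarr x (by simp [clamp])]
  have d₃ : s₃.rreg 0 = I.diam := r₃ 0
  refine Reach.seq (i := 27) (j := 27) (reach_levelLoop n₃ d₃ I.diam_pos rfl
    (by simp [a₃])) (fun s₄ f₄ h₄ => ?_) (by omega) (by omega)
  have n₄ : s₄.nreg 0 = I.n := (f₄.nreg 0 (by simp [levelLoop, raise])).trans n₃
  have d₄ : s₄.rreg 0 = I.diam := (f₄.rreg 0 (by simp [levelLoop, raise])).trans d₃
  have b₄ : ∀ x, s₄.rarr x = I.input.rarr x := fun x =>
    (f₄.rarr x (by simp [levelLoop, raise])).trans (b₃ x)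
  refine (reach_levelLoop n₄ d₄ I.diam_pos rfl
    (by rw [f₄.narr 2 (by simp [levelLoop, raise])]; simp [a₃])).imp le_rfl fun s₅ f₅ h₅ => ?_
  have b₅ : ∀ x, s₅.rarr x = I.input.rarr x := fun x =>
    (f₅.rarr x (by simp [levelLoop, raise])).trans (b₄ x)
  have a₅ : ∀ a, a ≠ 1 → a ≠ 2 → s₅.narr a = s₃.narr a := fun a h h' => by
    rw [f₅.narr a (by simp [levelLoop, raise, h']), f₄.narr a (by simp [levelLoop, raise, h])]
  refine ⟨⟨(f₅.nreg 0 (by simp [levelLoop, raise])).trans n₄,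
    (f₅.rreg 0 (by simp [levelLoop, raise])).trans d₄, b₅ 0, b₅ 1, b₅ 2, ?_, ?_, ?_, ?_, ?_⟩,
    ?_, ?_, ?_⟩
  · rw [f₅.narr 1 (by simp [levelLoop, raise])]
    rw [b₃] at h₄
    exact h₄
  · rw [b₄] at h₅
    exact h₅
  · rw [a₅ 3 (by omega) (by omega)]
    exact h₃
  · rw [a₅ 4 (by omega) (by omega), f₃.narr 4 (by simp [divTable])]
    exact h₂
  · rw [a₅ 7 (by omega) (by omega), a₃ 7 (by omega) (by omega)]
    exact fun _ => rfl
  · rw [f₅.nreg 1 (by simp [levelLoop, raise]), f₄.nreg 1 (by simp [levelLoop, raise]),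
      f₃.nreg 1 (by simp [divTable]), f₂.nreg 1 (by simp [mulTable]), h₁]
    rfl
  · rw [a₅ 0 (by omega) (by omega), a₃ 0 (by omega) (by omega)]
  · rw [f₅.rreg 2 (by simp [levelLoop, raise]), f₄.rreg 2 (by simp [levelLoop, raise]), r₃]
    rfl

/-- Since the diameter is positive, comparing squares is the same as comparing distances, and every
vertex is near itself, as the closed neighborhood demands. -/
theorem near_iff (I : UnitDiskInstance) (u v : Fin I.n) :
    Near (toArray fun i => I.point i 0) (toArray fun i => I.point i 1) I.diam u v ↔
      u = v ∨ I.graph.Adj u v := by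
  have h : Near (toArray fun i => I.point i 0) (toArray fun i => I.point i 1) I.diam u v ↔
      dist (I.point u) (I.point v) ≤ I.diam := by
    rw [EuclideanSpace.dist_eq, Real.sqrt_le_left I.diam_pos.le, Fin.sum_univ_two]
    simp only [Near, toArray_val, Real.dist_eq, sq, abs_mul_abs_self]
  rw [h]
  constructor
  · intro hd
    by_cases huv : u = v
    · exact Or.inl huv
    · exact Or.inr ⟨huv, hd⟩
  · rintro (rfl | huv)
    · rw [dist_self]; exact I.diam_pos.le
    · exact huv.2

theorem payoff_eq (I : UnitDiskInstance) (K : ℕ) (hK : 0 < K) (S : Finset (Fin I.n)) :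
    I.payoff S = (I.scene K hK).fullCov (S.map Fin.valEmbedding) := by
  classical
  unfold payoff SimpleGraph.coveredWeight SimpleGraph.dominatedBy Scene.fullCov coverage
  rw [Finset.sum_filter]
  refine Eq.trans ?_ (Finset.sum_range _).symm
  refine Finset.sum_congr rfl fun v _ => ?_
  have hiff : (∃ u ∈ S, u = v ∨ I.graph.Adj u v) ↔ CoveredIn (Near (toArray fun i => I.point i 0)
      (toArray fun i => I.point i 1) I.diam) (fun _ => ()) (S.map Fin.valEmbedding) v := by
    simp only [CoveredIn, Finset.mem_map, Fin.valEmbedding_apply]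
    constructor
    · rintro ⟨u, hu, huv⟩
      exact ⟨u, ⟨u, hu, rfl⟩, (I.near_iff u v).2 huv, trivial⟩
    · rintro ⟨_, ⟨u, hu, rfl⟩, huv, -⟩
      exact ⟨u, hu, (I.near_iff u v).1 huv⟩
  by_cases h : ∃ u ∈ S, u = v ∨ I.graph.Adj u v
  · rw [if_pos h]
    exact ((if_pos (hiff.1 h)).trans (toArray_val _ v)).symm
  · rw [if_neg h]
    exact (if_neg (hiff.not.1 h)).symm

theorem output_map (I : UnitDiskInstance) (s : Store) :
    (I.output s).map Fin.valEmbedding = setAt I.n s 0 0 := by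
  ext i
  simp only [output, setAt, Finset.mem_map, Finset.mem_filter, Finset.mem_univ, true_and,
    Fin.valEmbedding_apply, Finset.mem_range, zero_add]
  constructor
  · rintro ⟨j, hj, rfl⟩
    exact ⟨j.2, hj⟩
  · rintro ⟨hi, h⟩
    exact ⟨⟨i, hi⟩, h, rfl⟩

theorem exists_run_domination (I : UnitDiskInstance) {K : ℕ} (hK : 0 < K) :
    ∃ t s, Run (domination K) I.input t s ∧ t ≤ (I.n + 2) ^ (K + 8 * (K * K) + 71) ∧
      I.IsApproxSolution (1 - 4 / (K : ℝ)) (I.output s) := by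
  refine Reach.seq (n := I.n) (j := K + 8 * (K * K) + 70) (I.reach_setup K hK)
    (fun s₁ _ h₁ => ?_) (by omega) (by omega)
  obtain ⟨hE, hL, hout, hbest⟩ := h₁
  refine (reach_shiftLoop (D := I.scene K hK) hE (M := K * K) rfl hL (min_le_right _ _)
    (by simp [setAt, hout]) hbest).imp le_rfl fun s _ hs => ?_
  obtain ⟨hcard, hopt⟩ := hs
  have hset : setAt (I.scene K hK).n s 0 0 = (I.output s).map Fin.valEmbedding :=
    (I.output_map s).symm
  rw [hset] at hcard hopt
  refine ⟨?_, fun T hT => ?_⟩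
  · rw [Finset.card_map] at hcard
    exact hcard.trans (min_le_left _ _)
  · rw [I.payoff_eq K hK, I.payoff_eq K hK]
    refine hopt _ (fun i hi => ?_) ?_
    · obtain ⟨j, -, rfl⟩ := Finset.mem_map.1 hi
      exact Finset.mem_range.2 j.2
    · rw [Finset.card_map]
      exact le_min hT ((Finset.card_le_univ T).trans_eq (Fintype.card_fin _))

theorem payoff_nonneg (I : UnitDiskInstance) (S : Finset (Fin I.n)) : 0 ≤ I.payoff S := by
  unfold payoff SimpleGraph.coveredWeight
  exact Finset.sum_nonneg fun v _ => I.weight_nonneg v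

end UnitDiskInstance

/-! ### The choice of the grid size and the final estimate -/

/-- The change of base costs a factor 2 in the exponent, since `n + 2 ≤ max(n, 2)²`. -/
theorem Nat.cast_le_max_rpow {n t E : ℕ} {r : ℝ} (ht : t ≤ (n + 2) ^ E) (hE : 2 * (E : ℝ) ≤ r) :
    (t : ℝ) ≤ max (n : ℝ) 2 ^ r := by
  have h2 : 2 ≤ max (n : ℝ) 2 := le_max_right _ _
  have hn : (n : ℝ) ≤ max (n : ℝ) 2 := le_max_left _ _
  calc (t : ℝ) ≤ ((n : ℝ) + 2) ^ E := by exact_mod_cast ht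
    _ ≤ (max (n : ℝ) 2 ^ 2) ^ E := pow_le_pow_left₀ (by positivity) (by nlinarith) _
    _ = max (n : ℝ) 2 ^ (2 * (E : ℝ)) := by
      rw [← pow_mul, ← Real.rpow_natCast]
      push_cast
      rfl
    _ ≤ max (n : ℝ) 2 ^ r := Real.rpow_le_rpow_of_exponent_le (by linarith) hE

theorem theorem2 :
    ∃ C : ℝ, ∀ ℓ : ℝ, 1 < ℓ → ∃ A : RealRAM.Prog, ∀ I : UnitDiskInstance,
      ∃ (t : ℕ) (s : RealRAM.Store),
        RealRAM.Run A I.input t s ∧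
        (t : ℝ) ≤ (max (I.n : ℝ) 2) ^ (C * ℓ ^ 2) ∧
        I.IsApproxSolution (1 - 2 / ℓ) (I.output s) := by
  -- From `K < 2ℓ + 1 < 3ℓ` and `ℓ > 1`, twice the exponent `K + 8K² + 71` is at most `292ℓ²`, so
  -- 400 is ample.
  refine ⟨400, fun ℓ hℓ => ?_⟩
  obtain ⟨K, hKdef⟩ : ∃ K, K = ⌈2 * ℓ⌉₊ := ⟨_, rfl⟩
  have hK1 : 2 * ℓ ≤ K := hKdef ▸ Nat.le_ceil _
  have hK2 : (K : ℝ) < 2 * ℓ + 1 := hKdef ▸ Nat.ceil_lt_add_one (by linarith)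
  have hKr : (0 : ℝ) < K := by linarith
  have hK : 0 < K := Nat.cast_pos.1 hKr
  refine ⟨RealRAM.domination K, fun I => ?_⟩
  obtain ⟨t, s, hrun, ht, hfeas, hopt⟩ := I.exists_run_domination hK
  -- The guaranteed ratio `1 - 4 / K` is at least `1 - 2 / ℓ`. Payoffs are nonnegative, so it may be
  -- lowered to the latter even where that is negative.
  refine ⟨t, s, hrun, ?_, hfeas, fun T hT => (mul_le_mul_of_nonneg_right ?_
    (I.payoff_nonneg T)).trans (hopt T hT)⟩
  · refine Nat.cast_le_max_rpow ht ?_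
    push_cast
    have h₁ : (K : ℝ) * K ≤ 3 * ℓ * (3 * ℓ) :=
      mul_le_mul (by linarith only [hK2, hℓ]) (by linarith only [hK2, hℓ]) hKr.le
        (by linarith only [hℓ])
    have h₂ : ℓ ≤ ℓ ^ 2 := by nlinarith only [hℓ]
    linarith only [h₁, h₂, hK2, hℓ]
  · have : 4 / (K : ℝ) ≤ 2 / ℓ := by
      rw [div_le_div_iff₀ hKr (by linarith only [hℓ])]
      linarith only [hK1]
    linarith only [this]
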